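/- **Setting.** Let $\mathrm{Reg}_a=(\mathbb C^2)^{\otimes a}$ and $\sigma_m=I/2^m$ on $m$ qubits. A function $\mu:\mathbb N\to\mathbb R_{>0}$ is negligible if for every $c\in\mathbb N$ one has $\mu(n)<n^{-c}$ for all large $n$. A QPT algorithm is a family (indexed by $n$) of quantum circuits over the gate set $\{H,T,\mathrm{CNOT}\}$ with polynomially many gates and $|0\rangle$-ancillas, acting on an input state of polynomially many qubits and followed by a measurement of one qubit. The initial (input) states of an adversary are arbitrary, i.e. QPT adversaries are non-uniform and may hold an arbitrary quantum advice state; this convention is used both in the pseudorandomness assumption and in the conclusion. A QPT oracle algorithm may in addition apply the oracle unitary as a gate. A keyed family of unitaries $W_k$ is efficiently implementable if some polynomial-size circuit family outputs, on input any key $k$ and any pure state $\psi$, the state $W_k\psi$ with fidelity at least $1-\mathrm{negl}(n)$. **Pseudorandom unitaries.** A family $V_k$, $k\in\{0,1\}^{\lambda(n)}$, of $z(n)$-qubit unitaries, with $\lambda(n)$ and $n$ polynomially related, is a PRU if it is efficiently implementable and, for every QPT oracle algorithm $\mathcal A$, $\left|\Pr_{k}[\mathcal A^{V_k}=1]-\Pr_{U\sim\mathrm{Haar}}[\mathcal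 A^{U}=1]\right|\le\mathrm{negl}(\lambda(n))$. **PQAS.** Let $\ell(n),m(n)$ be polynomially bounded, $\ell,m=\omega(\log n)$, and $z=n+\ell+m$. Let $V^{(1)}_{k_1}$ be a PRU on $z$ qubits, $V^{(2)}_{k_2}$ an approximate unitary $4$-design of relative error $2^{-2m-\mathrm{polylog}(n)}$, and $V^{(3)}_{k_3}$ an exact unitary $2$-design, with keys $k_i$ uniform over bit strings of length $\lambda_i(n)$, where $\lambda=\lambda_1+\lambda_2+\lambda_3$ is polynomially bounded. (An ensemble is an approximate $t$-design of relative error $\epsilon$ if $\Phi_{\mathcal E}-(1-\epsilon)\Phi_{\rm Haar}$ and $(1+\epsilon)\Phi_{\rm Haar}-\Phi_{\mathcal E}$ are completely positive, where $\Phi(X)=\mathbb E_U[U^{\otimes t}XU^{\dagger\otimes t}]$; it is exact if $\epsilon=0$.) Assume that the family $U_k=V^{(1)}_{k_1}V^{(2)}_{k_2}V^{(3)}_{k_3}$, $k=(k_1,k_2,k_3)\in\{0,1\}^{\lambda(n)}$, is efficiently implementable. The PQAS encrypts an $n$-qubit state by $$\Phi_k(\rho)=U_k\left(\rho\otimes|0\rangle\langle0|^{\otimes\ell}\otimes\sigma_m\right)U_k^\dagger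 .$$ **Left-or-right experiment.** For a state $\rho_{\rm in}$ of a left and a right $n$-qubit register, $\mathrm{LR}_{k,0}(\rho_{\rm in})=\mathrm{tr}_{\rm right}\big((\Phi_k\otimes I)(\rho_{\rm in})\big)$ and $\mathrm{LR}_{k,1}(\rho_{\rm in})=\mathrm{tr}_{\rm left}\big((I\otimes\Phi_k)(\rho_{\rm in})\big)$. A non-adaptive adversary $\mathcal A$ with $t=\mathrm{poly}(n)$ queries holds an arbitrary (possibly entangled) state $\rho_{\rm g}$ of $t$ pairs of $n$-qubit registers and of $r=\mathrm{poly}(n)$ further qubits (such as $r=2tq$ purifying qubits). A uniformly random key $k\in\{0,1\}^\lambda$ and a bit $b$ are chosen, the $t$ pairs are sent through $\mathrm{LR}_{k,b}^{\otimes t}$, and $\mathcal A$ runs a QPT algorithm on $(\mathrm{LR}_{k,b}^{\otimes t}\otimes I)(\rho_{\rm g})$, which outputs a bit $b'$. **Theorem (non-adaptive CPA-security of PQAS).** For every PQAS and every such adversary $\mathcal A$ (with arbitrary polynomially bounded $t,r$ and arbitrary states $\rho_{\rm g}$), $$\left|\Pr_{k}\big[\mathcal A((\mathrm{LR}_{k,0}^{\otimes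 t}\otimes I)(\rho_{\rm g}))=1\big]-\Pr_{k}\big[\mathcal A((\mathrm{LR}_{k,1}^{\otimes t}\otimes I)(\rho_{\rm g}))=1\big]\right|\le\mathrm{negl}(\lambda(n)),$$ and, for uniformly random $b$, the adversary's success probability satisfies $\Pr[b'=b]\le\frac12+\mathrm{negl}(\lambda(n))$. -/

import Mathlib

open scoped Matrix Kronecker ComplexOrder
open MeasureTheory Filter

noncomputable section

namespace QCrypto

/-! ## Asymptotics -/

/-- Bounded by a polynomial. -/
def PolyBounded (f : ℕ → ℕ) : Prop :=
  ∃ p : Polynomial ℕ, ∀ n, f n ≤ p.eval n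

/-- A positive function that is eventually below every inverse polynomial. -/
def Negligible (μ : ℕ → ℝ) : Prop :=
  (∀ n, 0 < μ n) ∧ ∀ c : ℕ, ∃ n₀ : ℕ, ∀ n, n₀ < n → μ n < ((n : ℝ) ^ c)⁻¹

/-- `f n ≤ negl (s n)` for some negligible function `negl`. -/
def NegligibleIn (s : ℕ → ℕ) (f : ℕ → ℝ) : Prop :=
  ∃ μ : ℕ → ℝ, Negligible μ ∧ ∀ n, f n ≤ μ (s n)

/-- `f = ω(log n)`. -/
def SuperLogarithmic (f : ℕ → ℕ) : Prop :=
  (fun n : ℕ => Real.log n) =o[atTop] (fun n : ℕ => (f n : ℝ))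

/-- `f = polylog(n)`. -/
def PolyLog (f : ℕ → ℝ) : Prop :=
  ∃ c : ℕ, ∃ C : ℝ, ∀ n, 0 ≤ f n ∧ f n ≤ C * Real.log (n + 2) ^ c

/-! ## Registers of qubits, operators, states -/

/-- The computational basis of a register of qubits whose wires are labelled by `ι`. -/
abbrev Reg (ι : Type) : Type := ι → Bool

/-- Operators on the Hilbert space of the register `ι`. -/
abbrev Op (ι : Type) : Type := Matrix (Reg ι) (Reg ι) ℂ

/-- The unitary group of the register `ι`. -/
abbrev QU (ι : Type) [Fintype ι] [DecidableEq ι] := Matrix.unitaryGroup (Reg ι) ℂ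

/-- Density matrices: positive semidefinite of trace one. -/
def IsDensity {α : Type} [Fintype α] (ρ : Matrix α α ℂ) : Prop :=
  ρ.PosSemidef ∧ ρ.trace = 1

/-- The operator that acts as `M` on the wires `w` (assumed distinct) and trivially on all other
wires. -/
def onWires {κ ι : Type} [Fintype κ] [Fintype ι] [DecidableEq ι] (w : κ → ι) (M : Op κ) : Op ι :=
  Matrix.of fun x y => if ∀ i, (∀ j, w j ≠ i) → x i = y i then M (x ∘ w) (y ∘ w) else 0

/-- `ρ ⊗ |0…0⟩⟨0…0|` with `a` ancilla qubits. -/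
def withAncillas {ι : Type} (a : ℕ) (ρ : Op ι) : Op (ι ⊕ Fin a) :=
  Matrix.of fun x y =>
    if ∀ j : Fin a, x (Sum.inr j) = false ∧ y (Sum.inr j) = false then
      ρ (x ∘ Sum.inl) (y ∘ Sum.inl)
    else 0

/-! ## Haar measure on the unitary group -/

section Haar

variable (ι : Type) [Fintype ι] [DecidableEq ι]

instance : CompactSpace (QU ι) := by
  have hemb : Topology.IsClosedEmbedding
      (fun U : QU ι => fun i j => (U : Matrix (Reg ι) (Reg ι) ℂ) i j) := by
    refine ⟨Topology.IsEmbedding.subtypeVal, ?_⟩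
    have h : Set.range (fun U : QU ι => fun i j => (U : Matrix (Reg ι) (Reg ι) ℂ) i j)
        = {A : Matrix (Reg ι) (Reg ι) ℂ | star A * A = 1} ∩ {A | A * star A = 1} := by
      ext A
      constructor
      · rintro ⟨U, rfl⟩
        exact U.2
      · intro hA
        exact ⟨⟨A, hA⟩, rfl⟩
    rw [h]
    exact (isClosed_eq (by fun_prop : Continuous fun A : Matrix (Reg ι) (Reg ι) ℂ => star A * A)
      continuous_const).inter (isClosed_eq
        (by fun_prop : Continuous fun A : Matrix (Reg ι) (Reg ι) ℂ => A * star A)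
        continuous_const)
  refine ⟨?_⟩
  rw [hemb.isInducing.isCompact_iff]
  refine IsCompact.of_isClosed_subset
    (isCompact_univ_pi fun _ : Reg ι => isCompact_univ_pi fun _ : Reg ι =>
      isCompact_closedBall (0 : ℂ) 1) ?_ ?_
  · rw [Set.image_univ]
    exact hemb.isClosed_range
  · rintro _ ⟨U, -, rfl⟩ i - j -
    simpa using entry_norm_bound_of_unitary U.2 i j

instance : MeasurableSpace (QU ι) := borel _

instance : BorelSpace (QU ι) := ⟨rfl⟩

/-- The Haar probability measure on the unitary group. -/
def haarUnitary : Measure (QU ι) := Measure.haarMeasure ⊤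

end Haar

/-! ## Quantum circuits and algorithms -/

/-- The universal gate set `{H, T, CNOT}` acting on wires in `ι`. -/
inductive Gate (ι : Type) : Type
  | h (i : ι) : Gate ι
  | t (i : ι) : Gate ι
  | cnot (control target : ι) (ne : control ≠ target) : Gate ι

def hadamard : Op (Fin 1) :=
  Matrix.of fun x y => if x 0 && y 0 then -((Real.sqrt 2 : ℂ)⁻¹) else (Real.sqrt 2 : ℂ)⁻¹

def tMatrix : Op (Fin 1) :=
  Matrix.diagonal fun x => if x 0 then Complex.exp (Complex.I * Real.pi / 4) else 1

def cnotMatrix : Op (Fin 2) :=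
  Matrix.of fun x y => if x 0 = y 0 ∧ x 1 = xor (y 0) (y 1) then 1 else 0

def Gate.op {ι : Type} [Fintype ι] [DecidableEq ι] : Gate ι → Op ι
  | .h i => onWires (fun _ : Fin 1 => i) hadamard
  | .t i => onWires (fun _ : Fin 1 => i) tMatrix
  | .cnot c d _ => onWires ![c, d] cnotMatrix

/-- An elementary gate, or a query to a unitary oracle on the register `κ`. -/
inductive OracleGate (κ ι : Type) : Type
  | gate (g : Gate ι) : OracleGate κ ι
  | query (w : κ ↪ ι) : OracleGate κ ι

def OracleGate.op {κ ι : Type} [Fintype κ] [DecidableEq κ] [Fintype ι] [DecidableEq ι]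
    (U : QU κ) : OracleGate κ ι → Op ι
  | .gate g => g.op
  | .query w => onWires w (U : Op κ)

/-- The operator of a circuit; the head of the list is applied first. -/
def circuitOp {ι : Type} [Fintype ι] [DecidableEq ι] (l : List (Op ι)) : Op ι :=
  l.foldl (fun M g => g * M) 1

/-- A quantum algorithm with input register `ι` and gates from `G`: it adds `anc` ancillas in state
`|0⟩`, runs a circuit, and measures the wire `out`. -/
structure Algorithm (G : Type → Type) (ι : Type) where
  anc : ℕ
  circuit : List (G (ι ⊕ Fin anc))
  out : ι ⊕ Fin anc

namespace Algorithm

variable {G : Type → Type} {ι : Type}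

/-- Number of ancillas plus number of gates (and queries). -/
def size (A : Algorithm G ι) : ℕ := A.anc + A.circuit.length

/-- The probability that the algorithm outputs `b` on input state `ρ`, where `sem` interprets the
gates. -/
def outputProb [Fintype ι] [DecidableEq ι] (A : Algorithm G ι)
    (sem : G (ι ⊕ Fin A.anc) → Op (ι ⊕ Fin A.anc)) (ρ : Op ι) (b : Bool) : ℝ :=
  let C := circuitOp (A.circuit.map sem)
  ∑ x, if x A.out = b then ((C * withAncillas A.anc ρ * Cᴴ) x x).re else 0

end Algorithm

/-- A keyed family of unitaries is efficiently implementable: there are polynomial-size circuits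
(with ancillas) that take the key `k` and any state `ψ` to a state whose restriction to the data
register has fidelity at least `1 - negl(n)` with `W k ψ`. -/
def EfficientlyImplementable (K Z : ℕ → Type) [∀ n, Fintype (K n)] [∀ n, DecidableEq (K n)]
    [∀ n, Fintype (Z n)] [∀ n, DecidableEq (Z n)] (W : ∀ n, Reg (K n) → QU (Z n)) : Prop :=
  ∃ (anc : ℕ → ℕ) (C : ∀ n, List (Gate (K n ⊕ Z n ⊕ Fin (anc n)))) (ε : ℕ → ℝ),
    PolyBounded anc ∧ PolyBounded (fun n => (C n).length) ∧ Negligible ε ∧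
    ∀ (n : ℕ) (k : Reg (K n)) (ψ : Reg (Z n) → ℂ), ∑ y, ‖ψ y‖ ^ 2 = 1 →
      let input : Reg (K n ⊕ Z n ⊕ Fin (anc n)) → ℂ := fun x =>
        if x ∘ Sum.inl = k ∧ x ∘ Sum.inr ∘ Sum.inr = fun _ => false then
          ψ (x ∘ Sum.inr ∘ Sum.inl)
        else 0
      let output := circuitOp ((C n).map Gate.op) *ᵥ input
      let target := (W n k : Op (Z n)) *ᵥ ψ
      1 - ε n ≤ ∑ k' : Reg (K n), ∑ a : Reg (Fin (anc n)),
        ‖∑ y, star (target y) * output (Sum.elim k' (Sum.elim y a))‖ ^ 2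

/-! ## Pseudorandom unitaries -/

/-- The average over a uniformly random key. -/
def keyAverage {K : Type} [Fintype K] (f : K → ℝ) : ℝ := (∑ k, f k) / Fintype.card K

/-- A family of QPT oracle algorithms, with query access to a unitary on `z n` qubits: the `n`-th
member is a polynomial-size oracle circuit that starts in an arbitrary (advice) state of
polynomially many qubits. -/
structure OracleAdversary (z : ℕ → ℕ) where
  wires : ℕ → ℕ
  advice : ∀ n, Op (Fin (wires n))
  advice_density : ∀ n, IsDensity (advice n)
  alg : ∀ n, Algorithm (OracleGate (Fin (z n))) (Fin (wires n))
  wires_poly : PolyBounded wires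
  alg_poly : PolyBounded fun n => (alg n).size

/-- The probability that the adversary outputs `1` with oracle `U`. -/
def OracleAdversary.accept {z : ℕ → ℕ} (A : OracleAdversary z) (n : ℕ) (U : QU (Fin (z n))) : ℝ :=
  (A.alg n).outputProb (OracleGate.op U) (A.advice n) true

/-- Pseudorandom unitaries on `z n` qubits with keys in `{0,1}^(lam n)`; the security parameter
`lam n` and `n` are polynomially related. -/
structure IsPRU (z lam : ℕ → ℕ) (V : ∀ n, Reg (Fin (lam n)) → QU (Fin (z n))) : Prop where
  lam_poly : PolyBounded lam
  poly_lam : ∃ p : Polynomial ℕ, ∀ n, n ≤ p.eval (lam n)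
  efficient : EfficientlyImplementable (fun n => Fin (lam n)) (fun n => Fin (z n)) V
  pseudorandom : ∀ A : OracleAdversary z,
    NegligibleIn lam fun n =>
      |keyAverage (fun k => A.accept n (V n k)) - ∫ U, A.accept n U ∂haarUnitary (Fin (z n))|

/-! ## Unitary designs -/

/-- `U^{⊗ t}`. -/
def tensorPow {α : Type} (t : ℕ) (U : Matrix α α ℂ) : Matrix (Fin t → α) (Fin t → α) ℂ :=
  Matrix.of fun x y => ∏ s, U (x s) (y s)

/-- The `t`-fold Haar twirl `X ↦ E_U [U^{⊗t} X U^{†⊗t}]`. -/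
def haarTwirl (ι : Type) [Fintype ι] [DecidableEq ι] (t : ℕ)
    (X : Matrix (Fin t → Reg ι) (Fin t → Reg ι) ℂ) :
    Matrix (Fin t → Reg ι) (Fin t → Reg ι) ℂ :=
  Matrix.of fun x y =>
    ∫ U : QU ι, (tensorPow t (U : Op ι) * X * (tensorPow t (U : Op ι))ᴴ) x y ∂haarUnitary ι

/-- The `t`-fold twirl over a uniformly random element of a finite keyed ensemble. -/
def ensembleTwirl {ι K : Type} [Fintype ι] [DecidableEq ι] [Fintype K] (V : K → QU ι) (t : ℕ)
    (X : Matrix (Fin t → Reg ι) (Fin t → Reg ι) ℂ) :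
    Matrix (Fin t → Reg ι) (Fin t → Reg ι) ℂ :=
  (Fintype.card K : ℂ)⁻¹ • ∑ k, tensorPow t (V k : Op ι) * X * (tensorPow t (V k : Op ι))ᴴ

/-- Complete positivity: `Ψ ⊗ id` preserves positive semidefiniteness for every finite-dimensional
reference system. -/
def IsCompletelyPositive {α : Type} [Fintype α] (Ψ : Matrix α α ℂ → Matrix α α ℂ) : Prop :=
  ∀ (r : ℕ) (X : Matrix (α × Fin r) (α × Fin r) ℂ), X.PosSemidef →
    (Matrix.of fun p q : α × Fin r =>
      Ψ (Matrix.of fun i j => X (i, p.2) (j, q.2)) p.1 q.1).PosSemidef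

/-- Approximate unitary `t`-design with relative error `ε` (exact for `ε = 0`). -/
def IsApproxDesign {ι K : Type} [Fintype ι] [DecidableEq ι] [Fintype K] (V : K → QU ι) (t : ℕ)
    (ε : ℝ) : Prop :=
  IsCompletelyPositive (fun X => ensembleTwirl V t X - ((1 - ε : ℝ) : ℂ) • haarTwirl ι t X) ∧
  IsCompletelyPositive (fun X => ((1 + ε : ℝ) : ℂ) • haarTwirl ι t X - ensembleTwirl V t X)

/-! ## The pseudorandom quantum authentication scheme -/

/-- A pseudorandom quantum authentication scheme for `n`-qubit states: `tag n` tag qubits, `mix n`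
maximally mixed qubits, and keys `(k₁, k₂, k₃)` of `len₁ n + len₂ n + len₃ n` bits. -/
structure PQAS where
  tag : ℕ → ℕ
  mix : ℕ → ℕ
  len₁ : ℕ → ℕ
  len₂ : ℕ → ℕ
  len₃ : ℕ → ℕ
  V₁ : ∀ n, Reg (Fin (len₁ n)) → QU (Fin (n + tag n + mix n))
  V₂ : ∀ n, Reg (Fin (len₂ n)) → QU (Fin (n + tag n + mix n))
  V₃ : ∀ n, Reg (Fin (len₃ n)) → QU (Fin (n + tag n + mix n))
  tag_poly : PolyBounded tag
  mix_poly : PolyBounded mix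
  tag_superlog : SuperLogarithmic tag
  mix_superlog : SuperLogarithmic mix
  key_poly : PolyBounded fun n => len₁ n + len₂ n + len₃ n
  pru : IsPRU (fun n => n + tag n + mix n) len₁ V₁
  four_design : ∃ p : ℕ → ℝ, PolyLog p ∧
    ∀ n, IsApproxDesign (V₂ n) 4 ((2 : ℝ) ^ (-(2 * (mix n : ℝ)) - p n))
  two_design : ∀ n, IsApproxDesign (V₃ n) 2 0
  efficient : EfficientlyImplementable
    (fun n => Fin (len₁ n) ⊕ Fin (len₂ n) ⊕ Fin (len₃ n)) (fun n => Fin (n + tag n + mix n))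
    (fun n k => V₁ n (k ∘ Sum.inl) * V₂ n (k ∘ Sum.inr ∘ Sum.inl) * V₃ n (k ∘ Sum.inr ∘ Sum.inr))

/-- Concatenation of the basis labels of three consecutive registers. -/
def joinRegs (a b c : ℕ) :
    (Reg (Fin a) × Reg (Fin b)) × Reg (Fin c) ≃ Reg (Fin (a + b + c)) :=
  ((Fin.appendEquiv a b).prodCongr (Equiv.refl _)).trans (Fin.appendEquiv (a + b) c)

/-- `|0…0⟩⟨0…0|`. -/
def zeroState (ι : Type) [Fintype ι] [DecidableEq ι] : Op ι :=
  Matrix.single (fun _ => false) (fun _ => false) 1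

/-- `I / 2^|ι|`. -/
def maxMixed (ι : Type) [Fintype ι] [DecidableEq ι] : Op ι :=
  ((2 : ℂ) ^ Fintype.card ι)⁻¹ • 1

/-- The channel `ρ ↦ U (ρ ⊗ |0_ℓ⟩⟨0_ℓ| ⊗ σ_m) U†`. -/
def padAndScramble (n l m : ℕ) (U : QU (Fin (n + l + m))) :
    Op (Fin n) →ₗ[ℂ] Op (Fin (n + l + m)) where
  toFun ρ :=
    (U : Op (Fin (n + l + m))) *
      Matrix.reindex (joinRegs n l m) (joinRegs n l m)
        ((ρ ⊗ₖ zeroState (Fin l)) ⊗ₖ maxMixed (Fin m)) *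
      (U : Op (Fin (n + l + m)))ᴴ
  map_add' ρ τ := by
    simp only [Matrix.add_kronecker, Matrix.reindex_apply, Matrix.submatrix_add, Pi.add_apply,
      Matrix.mul_add, Matrix.add_mul]
  map_smul' c ρ := by
    simp only [Matrix.smul_kronecker, Matrix.reindex_apply, Matrix.submatrix_smul, Pi.smul_apply,
      Matrix.mul_smul, Matrix.smul_mul, RingHom.id_apply]

theorem padAndScramble_apply (n l m : ℕ) (U : QU (Fin (n + l + m))) (ρ : Op (Fin n)) :
    padAndScramble n l m U ρ =
      (U : Op (Fin (n + l + m))) *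
        Matrix.reindex (joinRegs n l m) (joinRegs n l m)
          ((ρ ⊗ₖ zeroState (Fin l)) ⊗ₖ maxMixed (Fin m)) *
        (U : Op (Fin (n + l + m)))ᴴ := rfl

namespace PQAS

/-- Number of qubits of a ciphertext. -/
def z (P : PQAS) (n : ℕ) : ℕ := n + P.tag n + P.mix n

/-- The security parameter: the total length of the key. -/
def lam (P : PQAS) (n : ℕ) : ℕ := P.len₁ n + P.len₂ n + P.len₃ n

/-- The key space `{0,1}^λ`, a key being `k = (k₁, k₂, k₃)`. -/
abbrev Key (P : PQAS) (n : ℕ) : Type :=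
  Reg (Fin (P.len₁ n)) × Reg (Fin (P.len₂ n)) × Reg (Fin (P.len₃ n))

/-- `U_k = V₁(k₁) V₂(k₂) V₃(k₃)`. -/
def unitary (P : PQAS) (n : ℕ) (k : P.Key n) : QU (Fin (P.z n)) :=
  P.V₁ n k.1 * P.V₂ n k.2.1 * P.V₃ n k.2.2

/-- The encryption channel `Φ_k`. -/
def encrypt (P : PQAS) (n : ℕ) (k : P.Key n) : Op (Fin n) →ₗ[ℂ] Op (Fin (P.z n)) :=
  padAndScramble n (P.tag n) (P.mix n) (P.unitary n k)

end PQAS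

/-! ## The left-or-right oracle experiment -/

section Channels

variable {α β γ : Type}

/-- `Φ ⊗ id`. -/
def ampliateRight (γ : Type) (Φ : Matrix α α ℂ →ₗ[ℂ] Matrix β β ℂ) :
    Matrix (α × γ) (α × γ) ℂ →ₗ[ℂ] Matrix (β × γ) (β × γ) ℂ where
  toFun X := Matrix.of fun p q => Φ (Matrix.of fun i j => X (i, p.2) (j, q.2)) p.1 q.1
  map_add' X Y := by
    ext p q
    exact congrFun (congrFun (map_add Φ (Matrix.of fun i j => X (i, p.2) (j, q.2))
      (Matrix.of fun i j => Y (i, p.2) (j, q.2))) p.1) q.1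
  map_smul' c X := by
    ext p q
    exact congrFun (congrFun (map_smul Φ c (Matrix.of fun i j => X (i, p.2) (j, q.2))) p.1) q.1

/-- `id ⊗ Φ`. -/
def ampliateLeft (γ : Type) (Φ : Matrix α α ℂ →ₗ[ℂ] Matrix β β ℂ) :
    Matrix (γ × α) (γ × α) ℂ →ₗ[ℂ] Matrix (γ × β) (γ × β) ℂ where
  toFun X := Matrix.of fun p q => Φ (Matrix.of fun i j => X (p.1, i) (q.1, j)) p.2 q.2
  map_add' X Y := by
    ext p q
    exact congrFun (congrFun (map_add Φ (Matrix.of fun i j => X (p.1, i) (q.1, j))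
      (Matrix.of fun i j => Y (p.1, i) (q.1, j))) p.2) q.2
  map_smul' c X := by
    ext p q
    exact congrFun (congrFun (map_smul Φ c (Matrix.of fun i j => X (p.1, i) (q.1, j))) p.2) q.2

/-- Partial trace over the second factor. -/
def traceSnd [Fintype γ] : Matrix (α × γ) (α × γ) ℂ →ₗ[ℂ] Matrix α α ℂ where
  toFun X := Matrix.of fun i j => ∑ c, X (i, c) (j, c)
  map_add' X Y := by ext i j; simp [Finset.sum_add_distrib]
  map_smul' c X := by ext i j; simp [Finset.mul_sum]

/-- Partial trace over the first factor. -/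
def traceFst [Fintype γ] : Matrix (γ × α) (γ × α) ℂ →ₗ[ℂ] Matrix α α ℂ where
  toFun X := Matrix.of fun i j => ∑ c, X (c, i) (c, j)
  map_add' X Y := by ext i j; simp [Finset.sum_add_distrib]
  map_smul' c X := by ext i j; simp [Finset.mul_sum]

/-- The left-or-right oracle: encrypt the left input (`b = 0`) or the right input (`b = 1`), and
trace out the other one. -/
def leftRight [Fintype α] (Φ : Matrix α α ℂ →ₗ[ℂ] Matrix β β ℂ) (b : Bool) :
    Matrix (α × α) (α × α) ℂ →ₗ[ℂ] Matrix β β ℂ :=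
  if b then traceFst ∘ₗ ampliateLeft α Φ else traceSnd ∘ₗ ampliateRight α Φ

/-- `Φ^{⊗t} ⊗ id_γ`, by linear extension from matrix units. -/
def parallel [Fintype α] [DecidableEq α] (t : ℕ) (Φ : Matrix α α ℂ →ₗ[ℂ] Matrix β β ℂ)
    (X : Matrix ((Fin t → α) × γ) ((Fin t → α) × γ) ℂ) :
    Matrix ((Fin t → β) × γ) ((Fin t → β) × γ) ℂ :=
  Matrix.of fun p q => ∑ i : Fin t → α, ∑ j : Fin t → α,
    X (i, p.2) (j, q.2) * ∏ s, Φ (Matrix.single (i s) (j s) 1) (p.1 s) (q.1 s)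

end Channels

/-- A state of `t` registers of `z` qubits and a reference of `r` qubits, as a state of one
register. -/
def flatten {t z r : ℕ}
    (X : Matrix ((Fin t → Reg (Fin z)) × Reg (Fin r)) ((Fin t → Reg (Fin z)) × Reg (Fin r)) ℂ) :
    Op ((Fin t × Fin z) ⊕ Fin r) :=
  X.submatrix (fun x => (fun s i => x (Sum.inl (s, i)), fun j => x (Sum.inr j)))
    (fun x => (fun s i => x (Sum.inl (s, i)), fun j => x (Sum.inr j)))

/-- A QPT adversary in the left-or-right experiment with `t n` non-adaptive queries. It holds an
arbitrary state of `t n` pairs (left input, right input) of `n`-qubit registers and of `r n` further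
qubits, which are not sent to the oracle. All of these may be entangled. After the queries, it runs
a polynomial-size circuit on the `t n` ciphertexts and its `r n` qubits. -/
structure CPAAdversary (P : PQAS) where
  t : ℕ → ℕ
  r : ℕ → ℕ
  state : ∀ n, Matrix ((Fin (t n) → Reg (Fin n) × Reg (Fin n)) × Reg (Fin (r n)))
    ((Fin (t n) → Reg (Fin n) × Reg (Fin n)) × Reg (Fin (r n))) ℂ
  state_density : ∀ n, IsDensity (state n)
  alg : ∀ n, Algorithm Gate ((Fin (t n) × Fin (P.z n)) ⊕ Fin (r n))
  t_poly : PolyBounded t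
  r_poly : PolyBounded r
  alg_poly : PolyBounded fun n => (alg n).size

namespace CPAAdversary

variable {P : PQAS}

/-- The probability, over a uniformly random key and the measurement, that the adversary outputs
`b'` when the oracle is the left-or-right oracle with bit `b`. -/
def outputProb (A : CPAAdversary P) (n : ℕ) (b b' : Bool) : ℝ :=
  keyAverage fun k : P.Key n =>
    (A.alg n).outputProb Gate.op
      (flatten (parallel (A.t n) (leftRight (P.encrypt n k) b) (A.state n))) b'

/-- The distinguishing advantage `|Pr[A = 1 | b = 0] - Pr[A = 1 | b = 1]|`. -/
def advantage (A : CPAAdversary P) (n : ℕ) : ℝ :=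
  |A.outputProb n false true - A.outputProb n true true|

/-- The probability that the adversary guesses a uniformly random bit `b`. -/
def successProb (A : CPAAdversary P) (n : ℕ) : ℝ :=
  (∑ b : Bool, A.outputProb n b b) / 2

end CPAAdversary

end QCrypto

end

/-!
Fix the bit `b` of the experiment. An adversary becomes an oracle adversary against `V₁` whose
advice state consists of its inputs already padded and scrambled by `V₂ V₃` with a random key: the
`t` oracle queries complete the encryption. By pseudorandomness, `V₁` may be replaced by a Haar
random unitary, and by right invariance of the Haar measure `V₂ V₃` then disappears.

The maximally mixed qubits are a uniformly random string for each of the `t` inputs. If these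
strings are distinct, so are the padded basis states of the `t` registers whatever the inputs are.
The Haar twirl maps `|x⟩⟨y|`, for a tuple `x` of distinct basis states, to `0` if some entry of
`x` is not an entry of `y` (flip its sign), and all the `|x⟩⟨x|` to one and the same operator
(permute the basis). Hence the average ciphertext depends only on the state of the reference,
which is the same for `b = 0` and `b = 1`. Two strings collide with probability at most `t² / 2^m`,
which is negligible since `m = ω(log n)`.
-/

noncomputable section

namespace QCrypto

open Asymptotics

/-! ## Asymptotics -/

theorem PolyBounded.mono {f g : ℕ → ℕ} (hg : PolyBounded g) (h : ∀ n, f n ≤ g n) :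
    PolyBounded f := by
  obtain ⟨p, hp⟩ := hg
  exact ⟨p, fun n => (h n).trans (hp n)⟩

theorem PolyBounded.add {f g : ℕ → ℕ} (hf : PolyBounded f) (hg : PolyBounded g) :
    PolyBounded fun n => f n + g n := by
  obtain ⟨p, hp⟩ := hf
  obtain ⟨q, hq⟩ := hg
  exact ⟨p + q, fun n => by rw [Polynomial.eval_add]; exact add_le_add (hp n) (hq n)⟩

theorem PolyBounded.mul {f g : ℕ → ℕ} (hf : PolyBounded f) (hg : PolyBounded g) :
    PolyBounded fun n => f n * g n := by
  obtain ⟨p, hp⟩ := hf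
  obtain ⟨q, hq⟩ := hg
  exact ⟨p * q, fun n => by rw [Polynomial.eval_mul]; exact Nat.mul_le_mul (hp n) (hq n)⟩

theorem polyBounded_id : PolyBounded fun n => n :=
  ⟨Polynomial.X, fun n => by rw [Polynomial.eval_X]⟩

theorem superpolynomialDecay_of_param_le_eval {α : Type*} {l : Filter α} {k k' f : α → ℝ}
    (hf : SuperpolynomialDecay l k f) (p : Polynomial ℝ) (hk' : ∀ x, 0 ≤ k' x)
    (hle : ∀ x, k' x ≤ p.eval (k x)) : SuperpolynomialDecay l k' f := by
  intro c
  refine squeeze_zero_norm (fun x => ?_) (by simpa using (hf.polynomial_mul (p ^ c) 0).norm)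
  rw [norm_mul, norm_pow, Real.norm_of_nonneg (hk' x), Real.norm_eq_abs]
  gcongr
  exacts [hk' x, (hle x).trans (le_abs_self _)]

theorem superpolynomialDecay_of_param_le_natEval {s s' : ℕ → ℕ} {f : ℕ → ℝ}
    (hf : SuperpolynomialDecay atTop (fun n => (s n : ℝ)) f) (p : Polynomial ℕ)
    (hp : ∀ n, s' n ≤ p.eval (s n)) :
    SuperpolynomialDecay atTop (fun n => (s' n : ℝ)) f := by
  refine superpolynomialDecay_of_param_le_eval hf (p.map (Nat.castRingHom ℝ))
    (fun n => Nat.cast_nonneg _) fun n => ?_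
  rw [Polynomial.eval_natCast_map, eq_natCast]
  exact_mod_cast hp n

theorem PolyBounded.mul_superpolynomialDecay {t : ℕ → ℕ} {f : ℕ → ℝ} (ht : PolyBounded t)
    (hf : SuperpolynomialDecay atTop (fun n : ℕ => (n : ℝ)) f) :
    SuperpolynomialDecay atTop (fun n : ℕ => (n : ℝ)) fun n => t n * f n := by
  obtain ⟨p, hp⟩ := ht
  refine (hf.polynomial_mul (p.map (Nat.castRingHom ℝ))).trans_abs_le fun n => ?_
  rw [Polynomial.eval_natCast_map, abs_mul, abs_mul, Nat.abs_cast, eq_natCast, Nat.abs_cast]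
  gcongr
  exact hp n

theorem tendsto_atTop_of_le_natEval {s : ℕ → ℕ} (p : Polynomial ℕ) (hp : ∀ n, n ≤ p.eval (s n)) :
    Tendsto s atTop atTop := by
  rw [← Nat.cofinite_eq_atTop]
  refine Tendsto.cofinite_of_finite_preimage_singleton fun l => ?_
  refine (Set.finite_Iic (p.eval l)).subset fun n hn => ?_
  rw [← (hn : s n = l)]
  exact hp n

theorem superpolynomialDecay_iff_eventually_abs_le {α : Type*} {l : Filter α} {k f : α → ℝ}
    (hk : Tendsto k l atTop) :
    SuperpolynomialDecay l k f ↔ ∀ c : ℕ, ∀ᶠ x in l, |f x| ≤ (k x ^ c)⁻¹ := by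
  have le_inv_iff : ∀ c : ℕ, ∀ x, 0 < k x → (|f x| ≤ (k x ^ c)⁻¹ ↔ |k x ^ c * f x| ≤ 1) := by
    intro c x hx
    rw [abs_mul, abs_of_pos (pow_pos hx c), ← le_inv_mul_iff₀ (pow_pos hx c), mul_one]
  refine ⟨fun h c => ?_, fun h => ?_⟩
  · filter_upwards [(h c).abs.eventually_le_const (by norm_num : |(0 : ℝ)| < 1),
      hk.eventually_gt_atTop 0] with x hx hpos
    exact (le_inv_iff c x hpos).2 hx
  · refine (superpolynomialDecay_iff_abs_isBoundedUnder f hk).2 fun c =>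
      isBoundedUnder_of_eventually_le (a := 1) ?_
    filter_upwards [h c, hk.eventually_gt_atTop 0] with x hx hpos
    exact (le_inv_iff c x hpos).1 hx

theorem negligible_iff {μ : ℕ → ℝ} :
    Negligible μ ↔
      (∀ n, 0 < μ n) ∧ SuperpolynomialDecay atTop (fun n : ℕ => (n : ℝ)) μ := by
  refine and_congr_right fun hpos => ⟨fun h => ?_, fun h c => ?_⟩
  · refine (superpolynomialDecay_iff_eventually_abs_le tendsto_natCast_atTop_atTop).2 fun c => ?_
    obtain ⟨n₀, hn₀⟩ := h c
    filter_upwards [eventually_gt_atTop n₀] with n hn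
    rw [abs_of_pos (hpos n)]
    exact (hn₀ n hn).le
  · obtain ⟨n₀, hn₀⟩ := eventually_atTop.1 ((h c).eventually_lt_const one_pos)
    refine ⟨n₀, fun n hn => ?_⟩
    have hn_pos : (0 : ℝ) < n := by exact_mod_cast n₀.zero_le.trans_lt hn
    rw [← mul_one ((n : ℝ) ^ c)⁻¹, lt_inv_mul_iff₀ (pow_pos hn_pos c)]
    exact hn₀ n hn.le

theorem superpolynomialDecay_pow_of_lt_one {x : ℝ} (hx₀ : 0 ≤ x) (hx₁ : x < 1) :
    SuperpolynomialDecay atTop (fun n : ℕ => (n : ℝ)) fun n => x ^ n := fun c =>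
  tendsto_pow_const_mul_const_pow_of_lt_one c hx₀ hx₁

theorem NegligibleIn.superpolynomialDecay {s : ℕ → ℕ} {f : ℕ → ℝ} (h : NegligibleIn s f)
    (hf : ∀ n, 0 ≤ f n) (hs : Tendsto s atTop atTop) :
    SuperpolynomialDecay atTop (fun n => (s n : ℝ)) f := by
  obtain ⟨μ, hμ, hle⟩ := h
  refine SuperpolynomialDecay.trans_abs_le (g := f) (f := μ ∘ s)
    (fun c => ((negligible_iff.1 hμ).2 c).comp hs) fun n => ?_
  rw [abs_of_nonneg (hf n)]
  exact (hle n).trans (le_abs_self _)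

theorem eventually_forall_fiber {s : ℕ → ℕ} {p : ℕ → Prop} (hp : ∀ᶠ n in atTop, p n) :
    ∀ᶠ l in atTop, ∀ n, s n = l → p n := by
  rw [← Nat.cofinite_eq_atTop] at hp ⊢
  refine ((eventually_cofinite.1 hp).image s).subset fun l hl => ?_
  simpa [and_comm] using hl

theorem superpolynomialDecay_iSup_fiber {s : ℕ → ℕ} {f : ℕ → ℝ} (hs : Tendsto s atTop atTop)
    (hf : SuperpolynomialDecay atTop (fun n => (s n : ℝ)) f) :
    SuperpolynomialDecay atTop (fun l : ℕ => (l : ℝ)) fun l => ⨆ n : s ⁻¹' {l}, |f n| := by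
  have eventually_le :=
    (superpolynomialDecay_iff_eventually_abs_le (tendsto_natCast_atTop_atTop.comp hs)).1 hf
  refine (superpolynomialDecay_iff_eventually_abs_le tendsto_natCast_atTop_atTop).2 fun c => ?_
  filter_upwards [eventually_forall_fiber (eventually_le c)] with l hl
  rw [abs_of_nonneg (Real.iSup_nonneg fun _ => abs_nonneg _)]
  refine Real.iSup_le ?_ (by positivity)
  rintro ⟨n, rfl⟩
  exact hl n rfl

theorem negligibleIn_of_superpolynomialDecay {s : ℕ → ℕ} {f : ℕ → ℝ}
    (hs : Tendsto s atTop atTop) (hf : SuperpolynomialDecay atTop (fun n => (s n : ℝ)) f) :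
    NegligibleIn s f := by
  have finite_fiber : ∀ l, (s ⁻¹' {l}).Finite := fun l =>
    (hs.eventually_ne_atTop l).exists_forall_of_atTop.elim fun n₀ hn₀ =>
      (Set.finite_lt_nat n₀).subset fun n hn => not_le.1 fun hle => hn₀ n hle hn
  have decay := (superpolynomialDecay_iSup_fiber hs hf).add
    (superpolynomialDecay_pow_of_lt_one (x := 2⁻¹) (by norm_num) (by norm_num))
  refine ⟨fun l => (⨆ n : s ⁻¹' {l}, |f n|) + 2⁻¹ ^ l, negligible_iff.2 ⟨fun l => ?_, decay⟩,
    fun n => ?_⟩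
  · exact add_pos_of_nonneg_of_pos (Real.iSup_nonneg fun _ => abs_nonneg _) (by positivity)
  · have : Finite (s ⁻¹' {s n}) := finite_fiber (s n)
    calc f n ≤ |f n| := le_abs_self _
      _ ≤ ⨆ n' : s ⁻¹' {s n}, |f n'| :=
        le_ciSup (f := fun n' : s ⁻¹' {s n} => |f n'|) (Set.finite_range _).bddAbove ⟨n, rfl⟩
      _ ≤ _ := le_add_of_nonneg_right (by positivity)

theorem SuperLogarithmic.superpolynomialDecay {m : ℕ → ℕ} (hm : SuperLogarithmic m) :
    SuperpolynomialDecay atTop (fun n : ℕ => (n : ℝ)) fun n => ((2 : ℝ) ^ m n)⁻¹ := by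
  refine (superpolynomialDecay_iff_eventually_abs_le tendsto_natCast_atTop_atTop).2 fun c => ?_
  filter_upwards [hm.def (c := Real.log 2 / (c + 1)) (by positivity), eventually_gt_atTop 0]
    with n hn hpos
  have hpos' : (0 : ℝ) < n := by exact_mod_cast hpos
  have log_nonneg : 0 ≤ Real.log n := Real.log_natCast_nonneg n
  rw [Real.norm_of_nonneg log_nonneg, Real.norm_of_nonneg (Nat.cast_nonneg _),
    div_mul_eq_mul_div, le_div_iff₀ (by positivity)] at hn
  rw [abs_of_pos (by positivity)]
  refine inv_anti₀ (by positivity) ((Real.log_le_log_iff (by positivity) (by positivity)).1 ?_)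
  rw [Real.log_pow, Real.log_pow]
  linarith

/-! ## Tensor products of matrices -/

section TensorFamily

variable {S α β γ R : Type*} [Fintype S] [CommSemiring R]

/-- The tensor product `⨂ₛ M s`; `tensorPow` is the case of a constant family indexed by `Fin t`. -/
def tensorFamily (M : S → Matrix α β R) : Matrix (S → α) (S → β) R :=
  Matrix.of fun x y => ∏ s, M s (x s) (y s)

theorem tensorFamily_apply (M : S → Matrix α β R) (x : S → α) (y : S → β) :
    tensorFamily M x y = ∏ s, M s (x s) (y s) :=
  rfl

theorem tensorPow_eq_tensorFamily {α : Type} (t : ℕ) (U : Matrix α α ℂ) :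
    tensorPow t U = tensorFamily fun _ : Fin t => U :=
  rfl

theorem tensorFamily_mul [DecidableEq S] [Fintype β] (M : S → Matrix α β R)
    (N : S → Matrix β γ R) :
    tensorFamily M * tensorFamily N = tensorFamily fun s => M s * N s := by
  ext x y
  simp only [tensorFamily_apply, Matrix.mul_apply, ← Finset.prod_mul_distrib, Finset.prod_univ_sum,
    Fintype.piFinset_univ]

theorem conjTranspose_tensorFamily [StarRing R] (M : S → Matrix α β R) :
    (tensorFamily M)ᴴ = tensorFamily fun s => (M s)ᴴ := by
  ext x y
  simp only [tensorFamily_apply, Matrix.conjTranspose_apply, star_prod]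

theorem tensorFamily_diagonal [DecidableEq α] (d : S → α → R) :
    (tensorFamily fun s => Matrix.diagonal (d s)) = Matrix.diagonal fun x => ∏ s, d s (x s) := by
  ext x y
  rw [tensorFamily_apply]
  obtain rfl | hxy := eq_or_ne x y
  · simp only [Matrix.diagonal_apply_eq]
  · obtain ⟨s, hs⟩ := Function.ne_iff.1 hxy
    rw [Matrix.diagonal_apply_ne _ hxy]
    exact Finset.prod_eq_zero (Finset.mem_univ s) (Matrix.diagonal_apply_ne _ hs)

theorem tensorFamily_one [DecidableEq α] :
    tensorFamily (fun _ : S => (1 : Matrix α α R)) = 1 := by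
  simp only [← Matrix.diagonal_one, tensorFamily_diagonal, Finset.prod_const_one]

theorem tensorFamily_single_one [DecidableEq α] [DecidableEq β] (x : S → α) (y : S → β) :
    tensorFamily (fun s => Matrix.single (x s) (y s) (1 : R)) = Matrix.single x y 1 := by
  ext x' y'
  simp only [tensorFamily_apply, Matrix.single_apply, Finset.prod_ite_zero, Finset.prod_const_one,
    Finset.mem_univ, true_imp_iff, forall_and, funext_iff]

theorem tensorFamily_ite_zero (p : S → Prop) [DecidablePred p] (M : S → Matrix α β R) :
    tensorFamily (fun s => if p s then M s else 0) = if ∀ s, p s then tensorFamily M else 0 := by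
  ext x y
  simp only [tensorFamily_apply, Matrix.ite_apply, Matrix.zero_apply, Finset.prod_ite_zero,
    Finset.mem_univ, true_imp_iff]

theorem tensorFamily_smul_sum [DecidableEq S] {K : Type*} [Fintype K] (c : R)
    (M : S → K → Matrix α β R) :
    tensorFamily (fun s => c • ∑ k, M s k)
      = c ^ Fintype.card S • ∑ σ : S → K, tensorFamily fun s => M s (σ s) := by
  ext x y
  simp only [tensorFamily_apply, Matrix.smul_apply, Matrix.sum_apply, smul_eq_mul,
    Finset.prod_mul_distrib, Finset.prod_const, Finset.card_univ, Finset.prod_univ_sum,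
    Fintype.piFinset_univ]

end TensorFamily

/-! ## Haar twirls of matrix units -/

theorem mul_single_one_mul_conjTranspose_apply {l m R : Type*} [Fintype m] [DecidableEq m]
    [Semiring R] [StarRing R] (A B : Matrix l m R) (a b : m) (x y : l) :
    (A * Matrix.single a b (1 : R) * Bᴴ) x y = A x a * star (B y b) := by
  simp [Matrix.single_eq_single_vecMulVec_single, Matrix.mul_vecMulVec, Matrix.vecMulVec_mul,
    Matrix.vecMulVec_apply]

theorem diagonal_mem_unitaryGroup {m : Type*} [Fintype m] [DecidableEq m] {d : m → ℂ}
    (hd : ∀ x, d x * star (d x) = 1) : Matrix.diagonal d ∈ Matrix.unitaryGroup m ℂ := by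
  rw [Matrix.mem_unitaryGroup_iff, Matrix.star_eq_conjTranspose, Matrix.diagonal_conjTranspose,
    Matrix.diagonal_mul_diagonal, ← Matrix.diagonal_one]
  exact congrArg _ (funext hd)

theorem permMatrix_mem_unitaryGroup {m : Type*} [Fintype m] [DecidableEq m] (σ : Equiv.Perm m) :
    σ.permMatrix ℂ ∈ Matrix.unitaryGroup m ℂ := by
  rw [Matrix.mem_unitaryGroup_iff, Matrix.star_eq_conjTranspose, Matrix.conjTranspose_permMatrix,
    ← Matrix.permMatrix_mul, inv_mul_cancel, Matrix.permMatrix_one]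

section Haar

variable {ι : Type} [Fintype ι] [DecidableEq ι]

instance : (haarUnitary ι).IsHaarMeasure := by
  unfold haarUnitary
  infer_instance

instance : IsProbabilityMeasure (haarUnitary ι) :=
  ⟨by simpa [haarUnitary] using
    Measure.haarMeasure_self (K₀ := (⊤ : TopologicalSpace.PositiveCompacts (QU ι)))⟩

instance : (haarUnitary ι).IsMulRightInvariant :=
  ⟨fun g => by
    have : IsProbabilityMeasure ((haarUnitary ι).map (· * g)) :=
      Measure.isProbabilityMeasure_map (measurable_mul_const g).aemeasurable
    have : ((haarUnitary ι).map (· * g)).IsHaarMeasure := inferInstance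
    exact Measure.isHaarMeasure_eq_of_isProbabilityMeasure _ _⟩

theorem continuous_unitary_entry (i j : Reg ι) : Continuous fun U : QU ι => (U : Op ι) i j :=
  (continuous_apply j).comp ((continuous_apply i).comp continuous_subtype_val)

theorem integrable_haarUnitary_of_continuous {E : Type*} [NormedAddCommGroup E] {f : QU ι → E}
    (hf : Continuous f) :
    Integrable f (haarUnitary ι) :=
  hf.integrable_of_hasCompactSupport (HasCompactSupport.of_compactSpace f)

variable {t : ℕ}

theorem continuous_twirl_apply (X : Matrix (Fin t → Reg ι) (Fin t → Reg ι) ℂ)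
    (x y : Fin t → Reg ι) :
    Continuous fun U : QU ι => (tensorPow t (U : Op ι) * X * (tensorPow t (U : Op ι))ᴴ) x y := by
  have continuous_tensorPow : Continuous fun U : QU ι => tensorPow t (U : Op ι) :=
    continuous_matrix fun x y =>
      continuous_finsetProd Finset.univ fun s _ => continuous_unitary_entry (x s) (y s)
  exact ((continuous_tensorPow.matrix_mul continuous_const).matrix_mul
    continuous_tensorPow.matrix_conjTranspose).matrix_elem x y

theorem isLinearMap_haarTwirl : IsLinearMap ℂ (haarTwirl ι t) where
  map_add X Y := by
    ext x y
    simp only [haarTwirl, Matrix.of_apply, Matrix.mul_add, Matrix.add_mul, Matrix.add_apply]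
    exact integral_add (integrable_haarUnitary_of_continuous (continuous_twirl_apply X x y))
      (integrable_haarUnitary_of_continuous (continuous_twirl_apply Y x y))
  map_smul c X := by
    ext x y
    simp only [haarTwirl, Matrix.of_apply, Matrix.mul_smul, Matrix.smul_mul, Matrix.smul_apply]
    exact integral_smul c _

theorem haarTwirl_conjugate (V : QU ι) (X : Matrix (Fin t → Reg ι) (Fin t → Reg ι) ℂ) :
    haarTwirl ι t (tensorPow t (V : Op ι) * X * (tensorPow t (V : Op ι))ᴴ) = haarTwirl ι t X := by
  ext x y
  simp only [haarTwirl, Matrix.of_apply]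
  rw [← integral_mul_right_eq_self
    (fun U : QU ι => (tensorPow t (U : Op ι) * X * (tensorPow t (U : Op ι))ᴴ) x y) V]
  simp only [Submonoid.coe_mul, tensorPow_eq_tensorFamily, ← tensorFamily_mul,
    Matrix.conjTranspose_mul, Matrix.mul_assoc]

/-- Conjugation by the unitary that flips the sign of `a s₀` alone negates the matrix unit. -/
theorem haarTwirl_single_eq_zero {a b : Fin t → Reg ι} (ha : Function.Injective a)
    {s₀ : Fin t} (hs₀ : a s₀ ∉ Set.range b) :
    haarTwirl ι t (Matrix.single a b 1) = 0 := by
  let d : Reg ι → ℂ := fun x => if x = a s₀ then -1 else 1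
  let V : QU ι := ⟨Matrix.diagonal d, diagonal_mem_unitaryGroup fun x => by
    simp only [d]; split_ifs <;> simp⟩
  have prod_a : ∏ s, d (a s) = -1 := by
    simp only [d, ha.eq_iff, Finset.prod_ite_eq', Finset.mem_univ, if_true]
  have prod_b : ∏ s, d (b s) = 1 := Finset.prod_eq_one fun s _ => if_neg fun h => hs₀ ⟨s, h⟩
  have hV : tensorPow t (V : Op ι) * Matrix.single a b 1 * (tensorPow t (V : Op ι))ᴴ
      = -Matrix.single a b 1 := by
    ext x y
    rw [tensorPow_eq_tensorFamily, tensorFamily_diagonal, Matrix.diagonal_conjTranspose,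
      Matrix.mul_diagonal, Matrix.diagonal_mul, Matrix.neg_apply, Matrix.single_apply,
      Pi.star_apply]
    split_ifs with h
    · rw [← h.1, ← h.2, prod_a, prod_b, star_one, mul_one, mul_one]
    · rw [mul_zero, zero_mul, neg_zero]
  have twirl_neg := haarTwirl_conjugate V (Matrix.single a b 1)
  rw [hV, isLinearMap_haarTwirl.map_neg] at twirl_neg
  ext x y
  exact self_eq_neg.1 (congrFun (congrFun twirl_neg x) y).symm

theorem haarTwirl_single_self_eq {a b : Fin t → Reg ι} (ha : Function.Injective a)
    (hb : Function.Injective b) :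
    haarTwirl ι t (Matrix.single a a 1) = haarTwirl ι t (Matrix.single b b 1) := by
  obtain ⟨σ, hσ⟩ := Equiv.Perm.exists_extending_pair b a hb ha
  let V : QU ι := ⟨σ.permMatrix ℂ, permMatrix_mem_unitaryGroup σ⟩
  have hV : tensorPow t (V : Op ι) * Matrix.single a a 1 * (tensorPow t (V : Op ι))ᴴ
      = Matrix.single b b 1 := by
    have column_a : ∀ x, tensorPow t (V : Op ι) x a = if b = x then 1 else 0 := by
      intro x
      have entry : ∀ s, (V : Op ι) (x s) (a s) = if b s = x s then 1 else 0 := by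
        intro s
        simp only [V, ← hσ, Equiv.Perm.permMatrix, PEquiv.toMatrix_apply, Equiv.toPEquiv_apply,
          Option.mem_some_iff, eq_comm (a := b s), EmbeddingLike.apply_eq_iff_eq]
      simp only [tensorPow, Matrix.of_apply, entry, Finset.prod_ite_zero, Finset.prod_const_one,
        Finset.mem_univ, true_imp_iff, ← funext_iff (f := b)]
    ext x y
    rw [mul_single_one_mul_conjTranspose_apply, column_a, column_a, Matrix.single_apply]
    by_cases hx : b = x <;> by_cases hy : b = y <;> simp [hx, hy]
  rw [← hV, haarTwirl_conjugate]

end Haar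

/-! ## Circuits -/

section OnWires

variable {κ ι ι' : Type} [Fintype κ] [Fintype ι] [DecidableEq ι] [Fintype ι'] [DecidableEq ι']

/-- The basis of a register, split into the basis of the wires selected by `w` and the basis of the
remaining wires. -/
def wireSplit {w : κ → ι} (hw : Function.Injective w) :
    Reg ι ≃ Reg κ × Reg {i // i ∉ Set.range w} :=
  (Equiv.piEquivPiSubtypeProd (· ∈ Set.range w) _).trans
    (((Equiv.ofInjective w hw).symm.arrowCongr (Equiv.refl Bool)).prodCongr (Equiv.refl _))

theorem onWires_eq_submatrix_kronecker_one {w : κ → ι} (hw : Function.Injective w) (M : Op κ) :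
    onWires w M = (M ⊗ₖ (1 : Op {i // i ∉ Set.range w})).submatrix (wireSplit hw)
      (wireSplit hw) := by
  ext x y
  have agree_off_range : (∀ i, (∀ j, w j ≠ i) → x i = y i) ↔
      (wireSplit hw x).2 = (wireSplit hw y).2 := by
    simp only [funext_iff, Subtype.forall, Set.mem_range, not_exists]
    rfl
  simp only [onWires, Matrix.of_apply, Matrix.submatrix_apply, Matrix.kroneckerMap_apply,
    Matrix.one_apply, mul_ite, mul_one, mul_zero]
  exact if_congr agree_off_range rfl rfl

theorem onWires_one {w : κ → ι} (hw : Function.Injective w) : onWires w (1 : Op κ) = 1 := by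
  rw [onWires_eq_submatrix_kronecker_one hw, Matrix.one_kronecker_one, Matrix.submatrix_one_equiv]

theorem conjTranspose_onWires {w : κ → ι} (hw : Function.Injective w) (M : Op κ) :
    (onWires w M)ᴴ = onWires w Mᴴ := by
  simp only [onWires_eq_submatrix_kronecker_one hw, Matrix.conjTranspose_submatrix,
    Matrix.conjTranspose_kronecker, Matrix.conjTranspose_one]

/-- Relabelling of the basis of a register along a relabelling of its wires. -/
def regEquiv {ι ι' : Type} (e : ι ≃ ι') : Reg ι' ≃ Reg ι := (e.arrowCongr (Equiv.refl Bool)).symm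

theorem onWires_equiv_comp (e : ι ≃ ι') (w : κ → ι) (M : Op κ) :
    onWires (e ∘ w) M = (onWires w M).submatrix (regEquiv e) (regEquiv e) := by
  ext x y
  have agree_iff : (∀ i, (∀ j, (e ∘ w) j ≠ i) → x i = y i) ↔
      ∀ i, (∀ j, w j ≠ i) → x (e i) = y (e i) := by
    rw [← e.forall_congr_right]
    simp only [Function.comp_apply, ne_eq, EmbeddingLike.apply_eq_iff_eq]
  exact if_congr agree_iff rfl rfl

variable [DecidableEq κ]

theorem onWires_mul {w : κ → ι} (hw : Function.Injective w) (M N : Op κ) :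
    onWires w (M * N) = onWires w M * onWires w N := by
  simp only [onWires_eq_submatrix_kronecker_one hw, Matrix.submatrix_mul_equiv,
    ← Matrix.mul_kronecker_mul, Matrix.one_mul]

theorem onWires_mem_unitaryGroup {w : κ → ι} (hw : Function.Injective w) {M : Op κ}
    (hM : M ∈ Matrix.unitaryGroup (Reg κ) ℂ) :
    onWires w M ∈ Matrix.unitaryGroup (Reg ι) ℂ := by
  rw [Matrix.mem_unitaryGroup_iff, Matrix.star_eq_conjTranspose] at hM ⊢
  rw [conjTranspose_onWires hw, ← onWires_mul hw, hM, onWires_one hw]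

end OnWires

theorem hadamard_mem_unitaryGroup : hadamard ∈ Matrix.unitaryGroup (Reg (Fin 1)) ℂ := by
  have inv_sqrt_two_mul_self : ((Real.sqrt 2 : ℂ))⁻¹ * ((Real.sqrt 2 : ℂ))⁻¹ = 2⁻¹ := by
    rw [← mul_inv, ← Complex.ofReal_mul, Real.mul_self_sqrt zero_le_two, Complex.ofReal_ofNat]
  rw [Matrix.mem_unitaryGroup_iff, Matrix.star_eq_conjTranspose]
  ext x y
  have hxy : x = y ↔ x 0 = y 0 := by rw [funext_iff, Fin.forall_fin_one]
  rw [Matrix.mul_apply, ← (Equiv.funUnique (Fin 1) Bool).symm.sum_comp]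
  simp only [hadamard, Matrix.of_apply, Matrix.conjTranspose_apply, Matrix.one_apply, hxy,
    Fintype.sum_bool]
  cases x 0 <;> cases y 0 <;> simp [inv_sqrt_two_mul_self] <;> norm_num

theorem tMatrix_mem_unitaryGroup : tMatrix ∈ Matrix.unitaryGroup (Reg (Fin 1)) ℂ :=
  diagonal_mem_unitaryGroup fun x => by
    split_ifs
    · rw [Complex.star_def, ← Complex.exp_conj, ← Complex.exp_add]
      simp [Complex.conj_ofReal, neg_div, map_ofNat]
    · simp

theorem cnotMatrix_mem_unitaryGroup : cnotMatrix ∈ Matrix.unitaryGroup (Reg (Fin 2)) ℂ := by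
  rw [Matrix.mem_unitaryGroup_iff, Matrix.star_eq_conjTranspose]
  ext x y
  have hxy : x = y ↔ x 0 = y 0 ∧ x 1 = y 1 := by rw [funext_iff, Fin.forall_fin_two]
  rw [Matrix.mul_apply, ← (finTwoArrowEquiv Bool).symm.sum_comp, Fintype.sum_prod_type]
  simp only [cnotMatrix, Matrix.of_apply, Matrix.conjTranspose_apply, Matrix.one_apply, hxy,
    Fintype.sum_bool, finTwoArrowEquiv_symm_apply]
  cases x 0 <;> cases y 0 <;> cases x 1 <;> cases y 1 <;> simp

section Circuits

variable {ι ι' κ : Type} [Fintype ι] [DecidableEq ι] [Fintype ι'] [DecidableEq ι'] [Fintype κ]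

theorem Gate.op_mem_unitaryGroup (g : Gate ι) : g.op ∈ Matrix.unitaryGroup (Reg ι) ℂ := by
  cases g with
  | h i =>
    exact onWires_mem_unitaryGroup (Function.injective_of_subsingleton _) hadamard_mem_unitaryGroup
  | t i =>
    exact onWires_mem_unitaryGroup (Function.injective_of_subsingleton _) tMatrix_mem_unitaryGroup
  | cnot c d ne =>
    refine onWires_mem_unitaryGroup ?_ cnotMatrix_mem_unitaryGroup
    intro i j hij
    fin_cases i <;> fin_cases j <;> simp_all [eq_comm]

theorem circuitOp_nil : circuitOp ([] : List (Op ι)) = 1 := rfl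

theorem foldl_mul_eq_circuitOp_mul (l : List (Op ι)) (N : Op ι) :
    l.foldl (fun M g => g * M) N = circuitOp l * N := by
  induction l generalizing N with
  | nil => rw [List.foldl_nil, circuitOp_nil, one_mul]
  | cons g l ih => rw [circuitOp, List.foldl_cons, List.foldl_cons, ih, ih, mul_one, mul_assoc]

theorem circuitOp_cons (g : Op ι) (l : List (Op ι)) : circuitOp (g :: l) = circuitOp l * g := by
  rw [circuitOp, List.foldl_cons, foldl_mul_eq_circuitOp_mul, mul_one]

theorem circuitOp_append (l l' : List (Op ι)) :
    circuitOp (l ++ l') = circuitOp l' * circuitOp l := by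
  rw [circuitOp, List.foldl_append, foldl_mul_eq_circuitOp_mul]
  rfl

theorem circuitOp_mem_unitaryGroup {l : List (Op ι)}
    (h : ∀ g ∈ l, g ∈ Matrix.unitaryGroup (Reg ι) ℂ) :
    circuitOp l ∈ Matrix.unitaryGroup (Reg ι) ℂ := by
  induction l with
  | nil => exact one_mem _
  | cons g l ih =>
    rw [circuitOp_cons]
    exact mul_mem (ih fun g' hg' => h g' (List.mem_cons_of_mem _ hg')) (h g List.mem_cons_self)

theorem circuitOp_map_submatrix (e : ι ≃ ι') (l : List (Op ι)) :
    circuitOp (l.map fun M => M.submatrix (regEquiv e) (regEquiv e))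
      = (circuitOp l).submatrix (regEquiv e) (regEquiv e) := by
  induction l with
  | nil => rw [List.map_nil, circuitOp_nil, circuitOp_nil, Matrix.submatrix_one_equiv]
  | cons g l ih =>
    rw [List.map_cons, circuitOp_cons, circuitOp_cons, ih, Matrix.submatrix_mul_equiv]

/-- The isometry that adds `a` ancillas in state `|0⟩`. -/
def ancillaIsometry (ι : Type) [Fintype ι] [DecidableEq ι] (a : ℕ) :
    Matrix (Reg (ι ⊕ Fin a)) (Reg ι) ℂ :=
  Matrix.of fun x i => if x = Sum.elim i (fun _ => false) then 1 else 0

theorem mul_ancillaIsometry_apply {α : Type} (a : ℕ) (N : Matrix α (Reg (ι ⊕ Fin a)) ℂ) (x : α)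
    (i : Reg ι) : (N * ancillaIsometry ι a) x i = N x (Sum.elim i fun _ => false) := by
  simp only [ancillaIsometry, Matrix.mul_apply, Matrix.of_apply, mul_ite, mul_one, mul_zero,
    Finset.sum_ite_eq', Finset.mem_univ, if_true]

theorem ancillaIsometry_mul_apply {α : Type} (a : ℕ) (N : Matrix (Reg ι) α ℂ)
    (x : Reg (ι ⊕ Fin a)) (y : α) :
    (ancillaIsometry ι a * N) x y
      = if ∀ j, x (Sum.inr j) = false then N (x ∘ Sum.inl) y else 0 := by
  have eq_elim_iff : ∀ i : Reg ι, x = Sum.elim i (fun _ => false) ↔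
      x ∘ Sum.inl = i ∧ ∀ j, x (Sum.inr j) = false := fun i => by
    rw [funext_iff, Sum.forall, funext_iff]
    rfl
  simp only [Matrix.mul_apply, ancillaIsometry, Matrix.of_apply, eq_elim_iff, ite_mul, one_mul,
    zero_mul]
  split_ifs with h <;> simp [h]

theorem conjTranspose_ancillaIsometry_mul_self (a : ℕ) :
    (ancillaIsometry ι a)ᴴ * ancillaIsometry ι a = 1 := by
  ext i j
  rw [mul_ancillaIsometry_apply]
  simp only [Matrix.conjTranspose_apply, ancillaIsometry, Matrix.of_apply, Matrix.one_apply,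
    Sum.elim_eq_iff, and_true, eq_comm (a := i), apply_ite star, star_one, star_zero]

theorem withAncillas_eq_conjugate (a : ℕ) (ρ : Op ι) :
    withAncillas a ρ = ancillaIsometry ι a * ρ * (ancillaIsometry ι a)ᴴ := by
  ext x y
  rw [Matrix.mul_assoc, ancillaIsometry_mul_apply, ← Matrix.conjTranspose_conjTranspose ρ,
    ← Matrix.conjTranspose_mul, Matrix.conjTranspose_apply, ancillaIsometry_mul_apply,
    Matrix.conjTranspose_conjTranspose]
  simp only [withAncillas, Matrix.of_apply, forall_and, ite_and, Matrix.conjTranspose_apply,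
    apply_ite star, star_zero, star_star]

theorem onWires_inl_mul_ancillaIsometry (w : κ → ι) (M : Op κ) (a : ℕ) :
    onWires (fun k => (Sum.inl (w k) : ι ⊕ Fin a)) M * ancillaIsometry ι a
      = ancillaIsometry ι a * onWires w M := by
  ext x i
  rw [mul_ancillaIsometry_apply, ancillaIsometry_mul_apply]
  simp only [onWires, Matrix.of_apply, Sum.forall, Sum.inl.injEq, ne_eq, reduceCtorEq,
    not_false_eq_true, implies_true, forall_const, Sum.elim_inl, Sum.elim_inr]
  simp only [and_comm (b := ∀ _ : Fin a, _), ite_and]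
  rfl

theorem circuitOp_inl_mul_ancillaIsometry {σ : Type} (w : σ → κ → ι) (M : Op κ) (a : ℕ)
    (l : List σ) :
    circuitOp (l.map fun s => onWires (fun k => (Sum.inl (w s k) : ι ⊕ Fin a)) M)
        * ancillaIsometry ι a
      = ancillaIsometry ι a * circuitOp (l.map fun s => onWires (w s) M) := by
  induction l with
  | nil => simp only [List.map_nil, circuitOp_nil, Matrix.one_mul, Matrix.mul_one]
  | cons s l ih =>
    rw [List.map_cons, List.map_cons, circuitOp_cons, circuitOp_cons, Matrix.mul_assoc,
      onWires_inl_mul_ancillaIsometry, ← Matrix.mul_assoc, ih, Matrix.mul_assoc]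

end Circuits

/-! ## Output probabilities of algorithms -/

section Density

variable {α β K : Type} [Fintype α] [Fintype β] [Fintype K]

theorem IsDensity.conjugate [DecidableEq α] {ρ : Matrix α α ℂ} (hρ : IsDensity ρ)
    {J : Matrix β α ℂ} (hJ : Jᴴ * J = 1) : IsDensity (J * ρ * Jᴴ) :=
  ⟨hρ.1.mul_mul_conjTranspose_same J, by
    rw [Matrix.trace_mul_comm, ← Matrix.mul_assoc, hJ, Matrix.one_mul, hρ.2]⟩

theorem IsDensity.average [Nonempty K] {ρ : K → Matrix α α ℂ} (hρ : ∀ k, IsDensity (ρ k)) :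
    IsDensity ((Fintype.card K : ℂ)⁻¹ • ∑ k, ρ k) := by
  refine ⟨(Matrix.posSemidef_sum _ fun k _ => (hρ k).1).smul ?_, ?_⟩
  · exact inv_nonneg.2 (Nat.cast_nonneg _)
  · simp [Matrix.trace_smul, Matrix.trace_sum, (hρ _).2]

theorem trace_submatrix_equiv (M : Matrix α α ℂ) (e : β ≃ α) :
    (M.submatrix e e).trace = M.trace :=
  e.sum_comp M.diag

theorem IsDensity.submatrix_equiv {ρ : Matrix α α ℂ} (hρ : IsDensity ρ) (e : β ≃ α) :
    IsDensity (ρ.submatrix e e) :=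
  ⟨hρ.1.submatrix e, (trace_submatrix_equiv ρ e).trans hρ.2⟩

end Density

/-- The projection onto the outcome `b` of a measurement of the wire `i`. -/
def wireProjection {ι : Type} [Fintype ι] (i : ι) (b : Bool) : Op ι :=
  Matrix.diagonal fun x => if x i = b then 1 else 0

theorem wireProjection_false_add_true {ι : Type} [Fintype ι] (i : ι) :
    wireProjection i false + wireProjection i true = 1 := by
  rw [wireProjection, wireProjection, Matrix.diagonal_add, ← Matrix.diagonal_one]
  congr 1
  ext x
  cases x i <;> simp

theorem wireProjection_equiv {ι ι' : Type} [Fintype ι] [Fintype ι'] (e : ι ≃ ι') (i : ι)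
    (b : Bool) :
    wireProjection (e i) b = (wireProjection i b).submatrix (regEquiv e) (regEquiv e) := by
  rw [wireProjection, wireProjection, Matrix.submatrix_diagonal_equiv]
  rfl

namespace Algorithm

variable {G : Type → Type} {ι ι' κ : Type} [Fintype ι] [DecidableEq ι] [Fintype ι']
  [DecidableEq ι'] [Fintype κ] [DecidableEq κ]

/-- The isometry implemented by an algorithm before its measurement. -/
def isometry (A : Algorithm G ι) (sem : G (ι ⊕ Fin A.anc) → Op (ι ⊕ Fin A.anc)) :
    Matrix (Reg (ι ⊕ Fin A.anc)) (Reg ι) ℂ :=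
  circuitOp (A.circuit.map sem) * ancillaIsometry ι A.anc

theorem conjTranspose_isometry_mul_self (A : Algorithm G ι)
    {sem : G (ι ⊕ Fin A.anc) → Op (ι ⊕ Fin A.anc)}
    (hsem : ∀ g, sem g ∈ Matrix.unitaryGroup (Reg (ι ⊕ Fin A.anc)) ℂ) :
    (A.isometry sem)ᴴ * A.isometry sem = 1 := by
  have circuit_unitary : (circuitOp (A.circuit.map sem))ᴴ * circuitOp (A.circuit.map sem) = 1 :=
    Matrix.mem_unitaryGroup_iff'.1 <| circuitOp_mem_unitaryGroup <|
      List.forall_mem_map.2 fun g _ => hsem g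
  rw [isometry, Matrix.conjTranspose_mul, Matrix.mul_assoc,
    ← Matrix.mul_assoc _ _ (ancillaIsometry ι A.anc), circuit_unitary, Matrix.one_mul,
    conjTranspose_ancillaIsometry_mul_self]

/-- The element of the binary POVM on the input register that is implemented by an algorithm and
corresponds to the output `b`. -/
def effect (A : Algorithm G ι) (sem : G (ι ⊕ Fin A.anc) → Op (ι ⊕ Fin A.anc)) (b : Bool) : Op ι :=
  (A.isometry sem)ᴴ * wireProjection A.out b * A.isometry sem

theorem outputProb_eq_re_trace (A : Algorithm G ι) (sem : G (ι ⊕ Fin A.anc) → Op (ι ⊕ Fin A.anc))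
    (ρ : Op ι) (b : Bool) : A.outputProb sem ρ b = (A.effect sem b * ρ).trace.re := by
  have trace_eq : (A.effect sem b * ρ).trace
      = (wireProjection A.out b * (A.isometry sem * ρ * (A.isometry sem)ᴴ)).trace := by
    rw [effect, Matrix.mul_assoc, Matrix.mul_assoc, Matrix.trace_mul_comm, Matrix.mul_assoc]
  rw [trace_eq, Matrix.trace, Complex.re_sum]
  simp only [outputProb, wireProjection, Matrix.diag_apply, Matrix.diagonal_mul, ite_mul, one_mul,
    zero_mul, apply_ite Complex.re, Complex.zero_re, isometry, withAncillas_eq_conjugate,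
    Matrix.conjTranspose_mul, Matrix.mul_assoc]

theorem effect_false_add_effect_true (A : Algorithm G ι)
    {sem : G (ι ⊕ Fin A.anc) → Op (ι ⊕ Fin A.anc)}
    (hsem : ∀ g, sem g ∈ Matrix.unitaryGroup (Reg (ι ⊕ Fin A.anc)) ℂ) :
    A.effect sem false + A.effect sem true = 1 := by
  rw [effect, effect, ← Matrix.add_mul, ← Matrix.mul_add, wireProjection_false_add_true,
    Matrix.mul_one, A.conjTranspose_isometry_mul_self hsem]

theorem outputProb_average {K : Type} [Fintype K] (A : Algorithm G ι)
    (sem : G (ι ⊕ Fin A.anc) → Op (ι ⊕ Fin A.anc)) (ρ : K → Op ι) (b : Bool) :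
    A.outputProb sem ((Fintype.card K : ℂ)⁻¹ • ∑ k, ρ k) b
      = keyAverage fun k => A.outputProb sem (ρ k) b := by
  simp only [outputProb_eq_re_trace, Matrix.mul_smul, Matrix.mul_sum, Matrix.trace_smul,
    Matrix.trace_sum, smul_eq_mul, keyAverage, inv_mul_eq_div, Complex.div_natCast_re,
    Complex.re_sum]

theorem outputProb_nonneg (A : Algorithm G ι) (sem : G (ι ⊕ Fin A.anc) → Op (ι ⊕ Fin A.anc))
    {ρ : Op ι} (hρ : ρ.PosSemidef) (b : Bool) : 0 ≤ A.outputProb sem ρ b := by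
  rw [outputProb, withAncillas_eq_conjugate]
  have output_posSemidef := (hρ.mul_mul_conjTranspose_same (ancillaIsometry ι A.anc)
    ).mul_mul_conjTranspose_same (circuitOp (A.circuit.map sem))
  refine Finset.sum_nonneg fun x _ => ?_
  split_ifs
  · exact (Complex.nonneg_iff.1 output_posSemidef.diag_nonneg).1
  · exact le_rfl

theorem outputProb_false_add_outputProb_true (A : Algorithm G ι)
    {sem : G (ι ⊕ Fin A.anc) → Op (ι ⊕ Fin A.anc)}
    (hsem : ∀ g, sem g ∈ Matrix.unitaryGroup (Reg (ι ⊕ Fin A.anc)) ℂ) {ρ : Op ι}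
    (hρ : IsDensity ρ) : A.outputProb sem ρ false + A.outputProb sem ρ true = 1 := by
  rw [outputProb_eq_re_trace, outputProb_eq_re_trace, ← Complex.add_re, ← Matrix.trace_add,
    ← Matrix.add_mul, A.effect_false_add_effect_true hsem, Matrix.one_mul, hρ.2, Complex.one_re]

theorem outputProb_le_one (A : Algorithm G ι) {sem : G (ι ⊕ Fin A.anc) → Op (ι ⊕ Fin A.anc)}
    (hsem : ∀ g, sem g ∈ Matrix.unitaryGroup (Reg (ι ⊕ Fin A.anc)) ℂ) {ρ : Op ι}
    (hρ : IsDensity ρ) (b : Bool) : A.outputProb sem ρ b ≤ 1 := by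
  have sum_eq_one := A.outputProb_false_add_outputProb_true hsem hρ
  have nonneg := A.outputProb_nonneg sem hρ.1
  cases b <;> linarith [nonneg false, nonneg true]

end Algorithm

/-! ## Relabelling of wires and parallel queries -/

section Relabel

variable {ι ι' κ : Type} [Fintype ι] [DecidableEq ι] [Fintype ι'] [DecidableEq ι'] [Fintype κ]
  [DecidableEq κ]

/-- Relabelling of the wires of a gate. -/
def Gate.map {ι ι' : Type} (e : ι ≃ ι') : Gate ι → Gate ι'
  | .h i => .h (e i)
  | .t i => .t (e i)
  | .cnot c d ne => .cnot (e c) (e d) (e.injective.ne ne)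

/-- Relabelling of the wires of an oracle gate. -/
def OracleGate.map {κ ι ι' : Type} (e : ι ≃ ι') : OracleGate κ ι → OracleGate κ ι'
  | .gate g => .gate (g.map e)
  | .query w => .query (w.trans e.toEmbedding)

theorem Gate.op_map (e : ι ≃ ι') (g : Gate ι) :
    (g.map e).op = g.op.submatrix (regEquiv e) (regEquiv e) := by
  cases g with
  | h i => exact onWires_equiv_comp e _ _
  | t i => exact onWires_equiv_comp e _ _
  | cnot c d ne =>
    have map_wires : ![e c, e d] = e ∘ ![c, d] := by
      ext i
      fin_cases i <;> rfl
    exact (congrArg (onWires · cnotMatrix) map_wires).trans (onWires_equiv_comp e _ _)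

theorem OracleGate.op_map (e : ι ≃ ι') (U : QU κ) (g : OracleGate κ ι) :
    (g.map e).op U = (g.op U).submatrix (regEquiv e) (regEquiv e) := by
  cases g with
  | gate g => exact g.op_map e
  | query w => exact onWires_equiv_comp e w U

namespace Algorithm

/-- Relabelling of the input wires of an oracle algorithm. -/
@[reducible]
def relabel {κ ι ι' : Type} (e : ι ≃ ι') (A : Algorithm (OracleGate κ) ι) :
    Algorithm (OracleGate κ) ι' where
  anc := A.anc
  circuit := A.circuit.map (OracleGate.map (e.sumCongr (Equiv.refl (Fin A.anc))))
  out := e.sumCongr (Equiv.refl (Fin A.anc)) A.out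

theorem isometry_relabel (e : ι ≃ ι') (A : Algorithm (OracleGate κ) ι) (U : QU κ) :
    (A.relabel e).isometry (OracleGate.op U) = (A.isometry (OracleGate.op U)).submatrix
      (regEquiv (e.sumCongr (Equiv.refl (Fin A.anc)))) (regEquiv e) := by
  have map_op : (A.relabel e).circuit.map (OracleGate.op U)
      = (A.circuit.map (OracleGate.op U)).map fun M =>
        M.submatrix (regEquiv (e.sumCongr (Equiv.refl (Fin A.anc))))
          (regEquiv (e.sumCongr (Equiv.refl (Fin A.anc)))) := by
    simp only [relabel, List.map_map, Function.comp_def, OracleGate.op_map]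
  have ancilla_submatrix : ancillaIsometry ι' A.anc = (ancillaIsometry ι A.anc).submatrix
      (regEquiv (e.sumCongr (Equiv.refl (Fin A.anc)))) (regEquiv e) := by
    ext x i
    have elim_regEquiv : Sum.elim (regEquiv e i) (fun _ => false)
        = regEquiv (e.sumCongr (Equiv.refl (Fin A.anc))) (Sum.elim i fun _ => false) := by
      ext (j | j) <;> rfl
    simp only [ancillaIsometry, Matrix.submatrix_apply, Matrix.of_apply, elim_regEquiv,
      EmbeddingLike.apply_eq_iff_eq]
  rw [isometry, map_op, circuitOp_map_submatrix, ancilla_submatrix, Matrix.submatrix_mul_equiv,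
    isometry]

theorem effect_relabel (e : ι ≃ ι') (A : Algorithm (OracleGate κ) ι) (U : QU κ) (b : Bool) :
    (A.relabel e).effect (OracleGate.op U) b
      = (A.effect (OracleGate.op U) b).submatrix (regEquiv e) (regEquiv e) := by
  rw [effect, isometry_relabel, wireProjection_equiv, Matrix.conjTranspose_submatrix,
    Matrix.submatrix_mul_equiv, Matrix.submatrix_mul_equiv, effect]

theorem outputProb_relabel (e : ι ≃ ι') (A : Algorithm (OracleGate κ) ι) (U : QU κ)
    (ρ : Op ι) (b : Bool) :
    (A.relabel e).outputProb (OracleGate.op U) (ρ.submatrix (regEquiv e) (regEquiv e)) b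
      = A.outputProb (OracleGate.op U) ρ b := by
  rw [outputProb_eq_re_trace, effect_relabel, Matrix.submatrix_mul_equiv,
    trace_submatrix_equiv, outputProb_eq_re_trace]

end Algorithm

end Relabel

section Queries

variable {t z r : ℕ}

/-- The wires of the `s`-th of `t` registers. -/
def blockWires (r : ℕ) (s : Fin t) : Fin z ↪ (Fin t × Fin z) ⊕ Fin r :=
  (Function.Embedding.sectR s (Fin z)).trans .inl

/-- The basis of a register of `t` blocks and a reference, as the product of the bases of the
blocks and of the reference. -/
def flattenEquiv (t z r : ℕ) :
    Reg ((Fin t × Fin z) ⊕ Fin r) ≃ (Fin t → Reg (Fin z)) × Reg (Fin r) :=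
  (Equiv.sumArrowEquivProdArrow _ _ _).trans
    ((Equiv.curry _ _ _).prodCongr (Equiv.refl _))

theorem flatten_eq_submatrix
    (X : Matrix ((Fin t → Reg (Fin z)) × Reg (Fin r)) ((Fin t → Reg (Fin z)) × Reg (Fin r)) ℂ) :
    flatten X = X.submatrix (flattenEquiv t z r) (flattenEquiv t z r) :=
  rfl

theorem onWires_blockWires (M : Op (Fin z)) (s : Fin t) :
    onWires (blockWires r s) M = (tensorFamily (Pi.mulSingle s M) ⊗ₖ (1 : Op (Fin r))).submatrix
      (flattenEquiv t z r) (flattenEquiv t z r) := by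
  ext x y
  have agree_iff : (∀ i, (∀ j, blockWires r s j ≠ i) → x i = y i) ↔
      (∀ s' ∈ Finset.univ.erase s, (flattenEquiv t z r x).1 s' = (flattenEquiv t z r y).1 s') ∧
        (flattenEquiv t z r x).2 = (flattenEquiv t z r y).2 := by
    constructor
    · intro h
      exact ⟨fun s' hs' => funext fun k => h (.inl (s', k)) fun j hj =>
        Finset.ne_of_mem_erase hs' (congrArg Prod.fst (Sum.inl_injective hj)).symm,
        funext fun k => h (.inr k) fun _ => Sum.inl_ne_inr⟩
    · rintro ⟨blocks, reference⟩ (⟨s', k⟩ | k) hi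
      · have hs' : s' ∈ Finset.univ.erase s :=
          Finset.mem_erase.2 ⟨fun h => hi k (h ▸ rfl), Finset.mem_univ s'⟩
        exact congrFun (blocks s' hs') k
      · exact congrFun reference k
  have entry_of_ne : ∀ s' ∈ Finset.univ.erase s, (Pi.mulSingle s M : Fin t → Op (Fin z)) s'
      ((flattenEquiv t z r x).1 s') ((flattenEquiv t z r y).1 s')
      = if (flattenEquiv t z r x).1 s' = (flattenEquiv t z r y).1 s' then 1 else 0 := by
    intro s' hs'
    rw [Pi.mulSingle_eq_of_ne (Finset.ne_of_mem_erase hs'), Matrix.one_apply]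
  rw [Matrix.submatrix_apply, Matrix.kroneckerMap_apply, tensorFamily_apply,
    ← Finset.mul_prod_erase _ _ (Finset.mem_univ s), Finset.prod_congr rfl entry_of_ne,
    Finset.prod_ite_zero, Finset.prod_const_one, Pi.mulSingle_eq_same, Matrix.one_apply]
  simp only [onWires, Matrix.of_apply, agree_iff, ite_and, mul_ite, mul_one, mul_zero]
  split_ifs <;> rfl

theorem circuitOp_blockWires_of_nodup (M : Op (Fin z)) {l : List (Fin t)} (hl : l.Nodup) :
    circuitOp (l.map fun s => onWires (blockWires r s) M)
      = (tensorFamily (fun s => if s ∈ l then M else 1) ⊗ₖ (1 : Op (Fin r))).submatrix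
        (flattenEquiv t z r) (flattenEquiv t z r) := by
  induction l with
  | nil =>
    simp only [List.map_nil, circuitOp_nil, List.not_mem_nil, if_false, tensorFamily_one,
      Matrix.one_kronecker_one, Matrix.submatrix_one_equiv]
  | cons s l ih =>
    obtain ⟨hs, hl⟩ := List.nodup_cons.1 hl
    have factor : ∀ s', (if s' ∈ l then M else 1) * (Pi.mulSingle s M : Fin t → Op (Fin z)) s'
        = if s' ∈ s :: l then M else 1 := by
      intro s'
      obtain rfl | hne := eq_or_ne s' s
      · rw [if_neg hs, Pi.mulSingle_eq_same, one_mul, if_pos List.mem_cons_self]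
      · simp only [Pi.mulSingle_eq_of_ne hne, mul_one, List.mem_cons, hne, false_or]
    rw [List.map_cons, circuitOp_cons, ih hl, onWires_blockWires, Matrix.submatrix_mul_equiv,
      ← Matrix.mul_kronecker_mul, tensorFamily_mul, Matrix.one_mul, funext factor]

theorem circuitOp_blockWires (M : Op (Fin z)) :
    circuitOp ((List.finRange t).map fun s => onWires (blockWires r s) M)
      = (tensorPow t M ⊗ₖ (1 : Op (Fin r))).submatrix (flattenEquiv t z r)
        (flattenEquiv t z r) := by
  simp only [circuitOp_blockWires_of_nodup M (List.nodup_finRange t), List.mem_finRange, if_true,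
    tensorPow_eq_tensorFamily]

/-- A register of `t` blocks of `z` qubits and `r` further qubits, as one block. -/
def wireEquiv (t z r : ℕ) : (Fin t × Fin z) ⊕ Fin r ≃ Fin (t * z + r) :=
  (finProdFinEquiv.sumCongr (Equiv.refl _)).trans finSumFinEquiv

/-- The operator `U` applied to each of `t` registers that are correlated with a reference `γ`. -/
def applyEach {α γ : Type} [Fintype α] [Fintype γ] [DecidableEq γ] (U : Matrix α α ℂ)
    (X : Matrix ((Fin t → α) × γ) ((Fin t → α) × γ) ℂ) :
    Matrix ((Fin t → α) × γ) ((Fin t → α) × γ) ℂ :=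
  (tensorPow t U ⊗ₖ (1 : Matrix γ γ ℂ)) * X * (tensorPow t U ⊗ₖ (1 : Matrix γ γ ℂ))ᴴ

namespace Algorithm

/-- The oracle algorithm that queries the oracle once on each of `t` registers and then runs `A`. -/
@[reducible]
def afterQueries (A : Algorithm Gate ((Fin t × Fin z) ⊕ Fin r)) :
    Algorithm (OracleGate (Fin z)) ((Fin t × Fin z) ⊕ Fin r) where
  anc := A.anc
  circuit := (List.finRange t).map (fun s => .query ((blockWires r s).trans .inl)) ++
    A.circuit.map .gate
  out := A.out

theorem isometry_afterQueries (A : Algorithm Gate ((Fin t × Fin z) ⊕ Fin r)) (U : QU (Fin z)) :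
    A.afterQueries.isometry (OracleGate.op U) = A.isometry Gate.op *
      (tensorPow t (U : Op (Fin z)) ⊗ₖ (1 : Op (Fin r))).submatrix (flattenEquiv t z r)
        (flattenEquiv t z r) := by
  have map_op : A.afterQueries.circuit.map (OracleGate.op U)
      = ((List.finRange t).map fun s => onWires (fun k => Sum.inl (blockWires r s k))
        (U : Op (Fin z))) ++ A.circuit.map Gate.op := by
    simp only [afterQueries, List.map_append, List.map_map]
    rfl
  rw [isometry, map_op, circuitOp_append, Matrix.mul_assoc,
    circuitOp_inl_mul_ancillaIsometry (fun s : Fin t => blockWires r s), circuitOp_blockWires,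
    ← Matrix.mul_assoc, isometry]

theorem effect_afterQueries (A : Algorithm Gate ((Fin t × Fin z) ⊕ Fin r)) (U : QU (Fin z))
    (b : Bool) :
    A.afterQueries.effect (OracleGate.op U) b
      = ((tensorPow t (U : Op (Fin z)) ⊗ₖ (1 : Op (Fin r))).submatrix (flattenEquiv t z r)
          (flattenEquiv t z r))ᴴ * A.effect Gate.op b *
        (tensorPow t (U : Op (Fin z)) ⊗ₖ (1 : Op (Fin r))).submatrix (flattenEquiv t z r)
          (flattenEquiv t z r) := by
  rw [effect, isometry_afterQueries, Matrix.conjTranspose_mul, effect]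
  simp only [Matrix.mul_assoc]

theorem outputProb_afterQueries (A : Algorithm Gate ((Fin t × Fin z) ⊕ Fin r)) (U : QU (Fin z))
    (X : Matrix ((Fin t → Reg (Fin z)) × Reg (Fin r)) ((Fin t → Reg (Fin z)) × Reg (Fin r)) ℂ)
    (b : Bool) :
    A.afterQueries.outputProb (OracleGate.op U) (flatten X) b
      = A.outputProb Gate.op (flatten (applyEach (U : Op (Fin z)) X)) b := by
  rw [outputProb_eq_re_trace, outputProb_eq_re_trace, effect_afterQueries, flatten_eq_submatrix,
    flatten_eq_submatrix, applyEach, ← Matrix.submatrix_mul_equiv _ _ _ (flattenEquiv t z r),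
    ← Matrix.submatrix_mul_equiv _ _ _ (flattenEquiv t z r), Matrix.mul_assoc, Matrix.mul_assoc,
    Matrix.trace_mul_comm, ← Matrix.conjTranspose_submatrix]
  simp only [Matrix.mul_assoc]

theorem size_relabel_afterQueries {ι' : Type} (A : Algorithm Gate ((Fin t × Fin z) ⊕ Fin r))
    (e : (Fin t × Fin z) ⊕ Fin r ≃ ι') : (A.afterQueries.relabel e).size = A.size + t := by
  simp only [size, List.length_map, List.length_append, List.length_finRange]
  omega

end Algorithm

end Queries

/-! ## The left-or-right oracle -/

section Blocks

variable {α β γ : Type}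

theorem kronecker_sum {l m n p R : Type*} [CommSemiring R] {K : Type*} [Fintype K]
    (A : Matrix l m R) (B : K → Matrix n p R) : A ⊗ₖ ∑ k, B k = ∑ k, A ⊗ₖ B k :=
  map_sum (Matrix.kroneckerBilinear (R := R) A) B Finset.univ

theorem sum_kronecker {l m n p R : Type*} [CommSemiring R] {K : Type*} [Fintype K]
    (A : K → Matrix l m R) (B : Matrix n p R) : (∑ k, A k) ⊗ₖ B = ∑ k, A k ⊗ₖ B :=
  map_sum ((Matrix.kroneckerBilinear (R := R)).flip B) A Finset.univ

/-- The block `⟨i|X|j⟩` of an operator, which acts on the second factor. -/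
def block (X : Matrix (α × γ) (α × γ) ℂ) (i j : α) : Matrix γ γ ℂ :=
  Matrix.of fun p q => X (i, p) (j, q)

theorem eq_sum_single_kronecker_block [Fintype α] [DecidableEq α]
    (X : Matrix (α × γ) (α × γ) ℂ) : X = ∑ i, ∑ j, Matrix.single i j 1 ⊗ₖ block X i j := by
  ext ⟨i, p⟩ ⟨j, q⟩
  simp [Matrix.sum_apply, Matrix.single_apply, block, ite_and]

theorem traceFst_eq_sum_block [Fintype α] (X : Matrix (α × γ) (α × γ) ℂ) :
    traceFst X = ∑ i, block X i i := by
  ext p q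
  simp only [traceFst, LinearMap.coe_mk, AddHom.coe_mk, Matrix.of_apply, Matrix.sum_apply, block]

theorem kronecker_one_conjugate_eq_sum [Fintype α] [DecidableEq α] [Fintype γ] [DecidableEq γ]
    (A : Matrix β α ℂ) (X : Matrix (α × γ) (α × γ) ℂ) :
    (A ⊗ₖ (1 : Matrix γ γ ℂ)) * X * (A ⊗ₖ (1 : Matrix γ γ ℂ))ᴴ
      = ∑ i, ∑ j, (A * Matrix.single i j (1 : ℂ) * Aᴴ) ⊗ₖ block X i j := by
  conv_lhs => rw [eq_sum_single_kronecker_block X]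
  simp only [Matrix.mul_sum, Matrix.sum_mul, Matrix.conjTranspose_kronecker,
    ← Matrix.mul_kronecker_mul, Matrix.conjTranspose_one, Matrix.one_mul, Matrix.mul_one]

theorem parallel_eq_sum [Fintype α] [DecidableEq α] {t : ℕ}
    (Φ : Matrix α α ℂ →ₗ[ℂ] Matrix β β ℂ)
    (X : Matrix ((Fin t → α) × γ) ((Fin t → α) × γ) ℂ) :
    parallel t Φ X
      = ∑ i, ∑ j, tensorFamily (fun s => Φ (Matrix.single (i s) (j s) 1)) ⊗ₖ block X i j := by
  ext p q
  simp only [parallel, Matrix.of_apply, Matrix.sum_apply, Matrix.kroneckerMap_apply,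
    tensorFamily_apply, block, mul_comm]

end Blocks

section LeftRight

variable {α β γ : Type}

/-- Swaps a pair if `b` is set, so that the encrypted component comes first. -/
def swapIf (α : Type) (b : Bool) : α × α ≃ α × α := if b then Equiv.prodComm α α else Equiv.refl _

/-- The family of pairs with given encrypted components and given discarded components. -/
def pairEquiv (α : Type) (t : ℕ) (b : Bool) :
    (Fin t → α) × (Fin t → α) ≃ (Fin t → α × α) :=
  (Equiv.arrowProdEquivProdArrow (Fin t) (fun _ => α) (fun _ => α)).symm.trans
    ((Equiv.refl _).arrowCongr (swapIf α b).symm)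

theorem swapIf_pairEquiv {t : ℕ} (b : Bool) (i c : Fin t → α) (s : Fin t) :
    swapIf α b (pairEquiv α t b (i, c) s) = (i s, c s) :=
  (swapIf α b).apply_symm_apply (i s, c s)

/-- The joint state of the inputs that are encrypted for the bit `b` and of the reference. -/
def selectInput {t : ℕ} [Fintype α] (b : Bool)
    (X : Matrix ((Fin t → α × α) × γ) ((Fin t → α × α) × γ) ℂ) :
    Matrix ((Fin t → α) × γ) ((Fin t → α) × γ) ℂ :=
  ∑ c : Fin t → α, X.submatrix (fun p => (pairEquiv α t b (p.1, c), p.2))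
    fun p => (pairEquiv α t b (p.1, c), p.2)

theorem block_selectInput {t : ℕ} [Fintype α] (b : Bool)
    (X : Matrix ((Fin t → α × α) × γ) ((Fin t → α × α) × γ) ℂ) (i j : Fin t → α) :
    block (selectInput b X) i j
      = ∑ c, block X (pairEquiv α t b (i, c)) (pairEquiv α t b (j, c)) := by
  ext p q
  simp only [block, selectInput, Matrix.of_apply, Matrix.sum_apply, Matrix.submatrix_apply]

theorem traceFst_selectInput {t : ℕ} [Fintype α] (b : Bool)
    (X : Matrix ((Fin t → α × α) × γ) ((Fin t → α × α) × γ) ℂ) :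
    traceFst (selectInput b X) = traceFst X := by
  rw [traceFst_eq_sum_block, traceFst_eq_sum_block, ← (pairEquiv α t b).sum_comp,
    Fintype.sum_prod_type]
  exact Finset.sum_congr rfl fun i _ => block_selectInput b X i i

theorem trace_traceFst [Fintype α] [Fintype γ] (X : Matrix (α × γ) (α × γ) ℂ) :
    (traceFst X).trace = X.trace :=
  (Fintype.sum_prod_type_right fun p => X p p).symm

theorem IsDensity.selectInput {t : ℕ} [Fintype α] [Fintype γ] (b : Bool)
    {X : Matrix ((Fin t → α × α) × γ) ((Fin t → α × α) × γ) ℂ} (hX : IsDensity X) :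
    IsDensity (selectInput b X) :=
  ⟨Matrix.posSemidef_sum _ fun _ _ => hX.1.submatrix _, by
    rw [← trace_traceFst, traceFst_selectInput, trace_traceFst, hX.2]⟩

theorem leftRight_false_kronecker [Fintype α] (Φ : Matrix α α ℂ →ₗ[ℂ] Matrix β β ℂ)
    (A B : Matrix α α ℂ) : leftRight Φ false (A ⊗ₖ B) = B.trace • Φ A := by
  have block_eq : ∀ c, (Matrix.of fun i j => (A ⊗ₖ B) (i, c) (j, c)) = B c c • A := fun c => by
    ext i j
    exact mul_comm _ _
  ext p q
  simp only [leftRight, Bool.false_eq_true, if_false, LinearMap.comp_apply, traceSnd,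
    ampliateRight, LinearMap.coe_mk, AddHom.coe_mk, Matrix.of_apply, block_eq, map_smul,
    Matrix.smul_apply, Matrix.trace, Matrix.diag_apply, Finset.sum_smul]

theorem leftRight_true_kronecker [Fintype α] (Φ : Matrix α α ℂ →ₗ[ℂ] Matrix β β ℂ)
    (A B : Matrix α α ℂ) : leftRight Φ true (A ⊗ₖ B) = A.trace • Φ B := by
  have block_eq : ∀ c, (Matrix.of fun i j => (A ⊗ₖ B) (c, i) (c, j)) = A c c • B := fun _ => rfl
  ext p q
  simp only [leftRight, if_true, LinearMap.comp_apply, traceFst, ampliateLeft, LinearMap.coe_mk,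
    AddHom.coe_mk, Matrix.of_apply, block_eq, map_smul, Matrix.smul_apply, Matrix.trace,
    Matrix.diag_apply, Finset.sum_smul]

theorem leftRight_single [Fintype α] [DecidableEq α] (Φ : Matrix α α ℂ →ₗ[ℂ] Matrix β β ℂ)
    (b : Bool) (u v : α × α) :
    leftRight Φ b (Matrix.single u v 1)
      = if (swapIf α b u).2 = (swapIf α b v).2 then
        Φ (Matrix.single (swapIf α b u).1 (swapIf α b v).1 1) else 0 := by
  have trace_single : ∀ x y : α, (Matrix.single x y (1 : ℂ)).trace = if x = y then 1 else 0 := by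
    intro x y
    split_ifs with h
    · rw [h, Matrix.trace_single_eq_same]
    · exact Matrix.trace_single_eq_of_ne _ _ _ h
  have single_eq : Matrix.single u v (1 : ℂ)
      = Matrix.single u.1 v.1 1 ⊗ₖ Matrix.single u.2 v.2 1 := by
    rw [Matrix.single_kronecker_single, mul_one]
  cases b
  · simp only [single_eq, leftRight_false_kronecker, trace_single, ite_smul, one_smul, zero_smul,
      swapIf, Bool.false_eq_true, if_false, Equiv.refl_apply]
  · simp only [single_eq, leftRight_true_kronecker, trace_single, ite_smul, one_smul, zero_smul,
      swapIf, if_true, Equiv.prodComm_apply, Prod.fst_swap, Prod.snd_swap]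

theorem parallel_leftRight {t : ℕ} [Fintype α] [DecidableEq α]
    (Φ : Matrix α α ℂ →ₗ[ℂ] Matrix β β ℂ) (b : Bool)
    (X : Matrix ((Fin t → α × α) × γ) ((Fin t → α × α) × γ) ℂ) :
    parallel t (leftRight Φ b) X = parallel t Φ (selectInput b X) := by
  have tensor_leftRight : ∀ (i c j d : Fin t → α) (B : Matrix γ γ ℂ),
      tensorFamily (fun s => leftRight Φ b
        (Matrix.single (pairEquiv α t b (i, c) s) (pairEquiv α t b (j, d) s) 1)) ⊗ₖ B
      = if c = d then tensorFamily (fun s => Φ (Matrix.single (i s) (j s) 1)) ⊗ₖ B else 0 := by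
    intro i c j d B
    simp only [leftRight_single, swapIf_pairEquiv, tensorFamily_ite_zero, funext_iff (f := c)]
    split_ifs
    · rfl
    · exact Matrix.zero_kronecker B
  simp only [parallel_eq_sum, block_selectInput, ← (pairEquiv α t b).sum_comp,
    Fintype.sum_prod_type, tensor_leftRight, kronecker_sum, Finset.sum_ite_eq, Finset.mem_univ,
    if_true]
  exact Finset.sum_congr rfl fun i _ => Finset.sum_comm

end LeftRight

/-! ## Encryption with given mixing strings -/

theorem kronecker_one_conjugate_kronecker {α β γ : Type} [Fintype α] [Fintype γ] [DecidableEq γ]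
    (A : Matrix β α ℂ) (B : Matrix α α ℂ) (C : Matrix γ γ ℂ) :
    (A ⊗ₖ (1 : Matrix γ γ ℂ)) * (B ⊗ₖ C) * (A ⊗ₖ (1 : Matrix γ γ ℂ))ᴴ = (A * B * Aᴴ) ⊗ₖ C := by
  rw [Matrix.conjTranspose_kronecker, ← Matrix.mul_kronecker_mul, ← Matrix.mul_kronecker_mul,
    Matrix.conjTranspose_one, Matrix.one_mul, Matrix.mul_one]

theorem conjTranspose_kronecker_one_mul_self {α β γ : Type} [Fintype β] [DecidableEq α] [Fintype γ]
    [DecidableEq γ] {J : Matrix β α ℂ} (hJ : Jᴴ * J = 1) :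
    (J ⊗ₖ (1 : Matrix γ γ ℂ))ᴴ * (J ⊗ₖ (1 : Matrix γ γ ℂ)) = 1 := by
  rw [Matrix.conjTranspose_kronecker, ← Matrix.mul_kronecker_mul, hJ, Matrix.conjTranspose_one,
    Matrix.one_mul, Matrix.one_kronecker_one]

theorem applyEach_mul {α γ : Type} {t : ℕ} [Fintype α] [Fintype γ] [DecidableEq γ]
    (U V : Matrix α α ℂ) (X : Matrix ((Fin t → α) × γ) ((Fin t → α) × γ) ℂ) :
    applyEach (U * V) X = applyEach U (applyEach V X) := by
  have tensorPow_mul : tensorPow t (U * V) ⊗ₖ (1 : Matrix γ γ ℂ)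
      = (tensorPow t U ⊗ₖ 1) * (tensorPow t V ⊗ₖ 1) := by
    rw [← Matrix.mul_kronecker_mul, Matrix.one_mul, tensorPow_eq_tensorFamily,
      tensorPow_eq_tensorFamily, tensorPow_eq_tensorFamily, tensorFamily_mul]
  simp only [applyEach, tensorPow_mul, Matrix.conjTranspose_mul, Matrix.mul_assoc]

theorem applyEach_smul_sum {α γ K : Type} {t : ℕ} [Fintype α] [Fintype γ] [DecidableEq γ]
    [Fintype K] (U : Matrix α α ℂ) (c : ℂ) (X : K → Matrix ((Fin t → α) × γ) ((Fin t → α) × γ) ℂ) :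
    applyEach U (c • ∑ k, X k) = c • ∑ k, applyEach U (X k) := by
  simp only [applyEach, Matrix.mul_smul, Matrix.smul_mul, Matrix.mul_sum, Matrix.sum_mul]

section Encryption

variable {n m t : ℕ} (l : ℕ)

/-- The label of the basis state `|i⟩|0…0⟩|σ⟩`. -/
def padded (i : Reg (Fin n)) (σ : Reg (Fin m)) : Reg (Fin (n + l + m)) :=
  joinRegs n l m ((i, fun _ => false), σ)

theorem padded_inj {i j : Reg (Fin n)} {σ τ : Reg (Fin m)} :
    padded l i σ = padded l j τ ↔ i = j ∧ σ = τ := by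
  simp only [padded, EmbeddingLike.apply_eq_iff_eq, Prod.mk.injEq, and_true]

theorem reindex_joinRegs_single (i j : Reg (Fin n)) :
    Matrix.reindex (joinRegs n l m) (joinRegs n l m)
        ((Matrix.single i j (1 : ℂ) ⊗ₖ zeroState (Fin l)) ⊗ₖ maxMixed (Fin m))
      = ((2 : ℂ) ^ m)⁻¹ • ∑ σ, Matrix.single (padded l i σ) (padded l j σ) 1 := by
  have maxMixed_eq : maxMixed (Fin m) = ((2 : ℂ) ^ m)⁻¹ • ∑ σ, Matrix.single σ σ 1 := by
    rw [maxMixed, Fintype.card_fin, Matrix.sum_single_one]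
  rw [maxMixed_eq, zeroState, Matrix.single_kronecker_single, mul_one, Matrix.kronecker_smul,
    kronecker_sum]
  simp only [← Matrix.coe_reindexLinearEquiv ℂ ℂ, map_smul, map_sum,
    Matrix.single_kronecker_single, mul_one]
  simp only [Matrix.coe_reindexLinearEquiv, Matrix.reindex_apply, Matrix.submatrix_single_equiv,
    Equiv.symm_symm, padded]

theorem padAndScramble_single (U : QU (Fin (n + l + m))) (i j : Reg (Fin n)) :
    padAndScramble n l m U (Matrix.single i j 1)
      = ((2 : ℂ) ^ m)⁻¹ • ∑ σ, (U : Op (Fin (n + l + m))) *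
        Matrix.single (padded l i σ) (padded l j σ) (1 : ℂ) * (U : Op (Fin (n + l + m)))ᴴ := by
  rw [padAndScramble_apply, reindex_joinRegs_single, Matrix.mul_smul, Matrix.smul_mul,
    Matrix.mul_sum, Matrix.sum_mul]

/-- The labels `|i s⟩|0…0⟩|σ s⟩` of `t` padded inputs. -/
def padInput (σ : Fin t → Reg (Fin m)) (i : Fin t → Reg (Fin n)) :
    Fin t → Reg (Fin (n + l + m)) :=
  fun s => padded l (i s) (σ s)

theorem padInput_injective (σ : Fin t → Reg (Fin m)) :
    Function.Injective (padInput (n := n) l σ) :=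
  fun _ _ h => funext fun s => ((padded_inj l).1 (congrFun h s)).1

/-- The isometry that appends zeros and the mixing strings `σ` to `t` registers. -/
def padIsometry (n : ℕ) (σ : Fin t → Reg (Fin m)) :
    Matrix (Fin t → Reg (Fin (n + l + m))) (Fin t → Reg (Fin n)) ℂ :=
  (1 : Matrix (Fin t → Reg (Fin (n + l + m))) _ ℂ).submatrix id (padInput l σ)

theorem conjTranspose_padIsometry_mul_self (σ : Fin t → Reg (Fin m)) :
    (padIsometry l n σ)ᴴ * padIsometry l n σ = 1 := by
  rw [padIsometry, Matrix.conjTranspose_submatrix, Matrix.conjTranspose_one, ← Equiv.coe_refl,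
    Matrix.submatrix_mul_equiv, Matrix.one_mul, Matrix.submatrix_one _ (padInput_injective l σ)]

theorem padIsometry_mul_single_mul_conjTranspose (σ : Fin t → Reg (Fin m))
    (i j : Fin t → Reg (Fin n)) :
    padIsometry l n σ * Matrix.single i j (1 : ℂ) * (padIsometry l n σ)ᴴ
      = Matrix.single (padInput l σ i) (padInput l σ j) 1 := by
  ext x y
  rw [mul_single_one_mul_conjTranspose_apply]
  simp only [padIsometry, Matrix.submatrix_apply, id, Matrix.one_apply, Matrix.single_apply,
    apply_ite star, star_one, star_zero, mul_ite, mul_one, mul_zero, ite_and, eq_comm]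
  split_ifs <;> rfl

variable {γ : Type} [Fintype γ] [DecidableEq γ]

/-- The joint state of the reference and of `t` inputs padded with zeros and with the mixing
strings `σ`. -/
def padState (σ : Fin t → Reg (Fin m))
    (Y : Matrix ((Fin t → Reg (Fin n)) × γ) ((Fin t → Reg (Fin n)) × γ) ℂ) :
    Matrix ((Fin t → Reg (Fin (n + l + m))) × γ) ((Fin t → Reg (Fin (n + l + m))) × γ) ℂ :=
  (padIsometry l n σ ⊗ₖ (1 : Matrix γ γ ℂ)) * Y * (padIsometry l n σ ⊗ₖ (1 : Matrix γ γ ℂ))ᴴ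

theorem IsDensity.padState (σ : Fin t → Reg (Fin m))
    {Y : Matrix ((Fin t → Reg (Fin n)) × γ) ((Fin t → Reg (Fin n)) × γ) ℂ} (hY : IsDensity Y) :
    IsDensity (padState l σ Y) :=
  hY.conjugate (conjTranspose_kronecker_one_mul_self (conjTranspose_padIsometry_mul_self l σ))

theorem IsDensity.applyEach {α : Type} [Fintype α] [DecidableEq α]
    {X : Matrix ((Fin t → α) × γ) ((Fin t → α) × γ) ℂ} (hX : IsDensity X)
    {U : Matrix α α ℂ} (hU : U ∈ Matrix.unitaryGroup α ℂ) : IsDensity (applyEach U X) :=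
  hX.conjugate <| conjTranspose_kronecker_one_mul_self <| by
    rw [tensorPow_eq_tensorFamily, conjTranspose_tensorFamily, tensorFamily_mul,
      ← Matrix.star_eq_conjTranspose, Matrix.mem_unitaryGroup_iff'.1 hU, tensorFamily_one]

theorem applyEach_padState (U : Op (Fin (n + l + m))) (σ : Fin t → Reg (Fin m))
    (Y : Matrix ((Fin t → Reg (Fin n)) × γ) ((Fin t → Reg (Fin n)) × γ) ℂ) :
    applyEach U (padState l σ Y) = ∑ i, ∑ j, (tensorPow t U *
      Matrix.single (padInput l σ i) (padInput l σ j) (1 : ℂ) * (tensorPow t U)ᴴ) ⊗ₖ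
        block Y i j := by
  have padState_eq_sum : padState l σ Y
      = ∑ i, ∑ j, Matrix.single (padInput l σ i) (padInput l σ j) 1 ⊗ₖ block Y i j := by
    simp only [padState, kronecker_one_conjugate_eq_sum, padIsometry_mul_single_mul_conjTranspose]
  simp only [padState_eq_sum, applyEach, Matrix.mul_sum, Matrix.sum_mul,
    kronecker_one_conjugate_kronecker]

theorem parallel_padAndScramble (U : QU (Fin (n + l + m)))
    (Y : Matrix ((Fin t → Reg (Fin n)) × γ) ((Fin t → Reg (Fin n)) × γ) ℂ) :
    parallel t (padAndScramble n l m U) Y = (Fintype.card (Fin t → Reg (Fin m)) : ℂ)⁻¹ •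
      ∑ σ, applyEach (U : Op (Fin (n + l + m))) (padState l σ Y) := by
  have tensor_padAndScramble : ∀ i j : Fin t → Reg (Fin n),
      tensorFamily (fun s => padAndScramble n l m U (Matrix.single (i s) (j s) 1))
        = (Fintype.card (Fin t → Reg (Fin m)) : ℂ)⁻¹ • ∑ σ, tensorPow t (U : Op _) *
          Matrix.single (padInput l σ i) (padInput l σ j) (1 : ℂ) * (tensorPow t (U : Op _))ᴴ := by
    intro i j
    simp only [padAndScramble_single, tensorFamily_smul_sum, ← tensorFamily_mul,
      ← conjTranspose_tensorFamily, tensorFamily_single_one, tensorPow_eq_tensorFamily]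
    congr 1
    simp only [Fintype.card_fun, Fintype.card_fin, Fintype.card_bool, Nat.cast_pow, Nat.cast_ofNat,
      inv_pow]
  simp only [parallel_eq_sum, tensor_padAndScramble, applyEach_padState, Matrix.smul_kronecker,
    sum_kronecker, ← Finset.smul_sum]
  rw [Finset.sum_comm_cycle]

theorem applyEach_parallel_padAndScramble (U V : QU (Fin (n + l + m)))
    (Y : Matrix ((Fin t → Reg (Fin n)) × γ) ((Fin t → Reg (Fin n)) × γ) ℂ) :
    applyEach (U : Op (Fin (n + l + m))) (parallel t (padAndScramble n l m V) Y)
      = parallel t (padAndScramble n l m (U * V)) Y := by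
  simp only [parallel_padAndScramble, applyEach_smul_sum, Submonoid.coe_mul, applyEach_mul]

end Encryption

theorem IsDensity.parallel_padAndScramble {n l m t : ℕ} {γ : Type} [Fintype γ]
    (U : QU (Fin (n + l + m)))
    {Y : Matrix ((Fin t → Reg (Fin n)) × γ) ((Fin t → Reg (Fin n)) × γ) ℂ} (hY : IsDensity Y) :
    IsDensity (parallel t (padAndScramble n l m U) Y) := by
  classical
  rw [QCrypto.parallel_padAndScramble]
  exact .average fun σ => (hY.padState l σ).applyEach U.2

/-! ## Encryption with a Haar random unitary -/

section LinearMapTwirl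

variable {ι : Type} [Fintype ι] [DecidableEq ι] {t : ℕ}

theorem linearMap_apply_eq_sum {α : Type} [Fintype α] [DecidableEq α]
    (F : Matrix α α ℂ →ₗ[ℂ] ℂ) (M : Matrix α α ℂ) :
    F M = ∑ p, ∑ q, M p q * F (Matrix.single p q 1) := by
  conv_lhs => rw [Matrix.matrix_eq_sum_single M]
  simp only [map_sum]
  refine Finset.sum_congr rfl fun p _ => Finset.sum_congr rfl fun q _ => ?_
  rw [← smul_eq_mul, ← map_smul, Matrix.smul_single, smul_eq_mul, mul_one]

variable (F : Matrix (Fin t → Reg ι) (Fin t → Reg ι) ℂ →ₗ[ℂ] ℂ)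
  (X : Matrix (Fin t → Reg ι) (Fin t → Reg ι) ℂ)

theorem continuous_linearMap_twirl :
    Continuous fun U : QU ι => F (tensorPow t (U : Op ι) * X * (tensorPow t (U : Op ι))ᴴ) := by
  simp only [linearMap_apply_eq_sum F (_ * _ * _)]
  exact continuous_finsetSum _ fun x _ => continuous_finsetSum _ fun y _ =>
    (continuous_twirl_apply X x y).mul continuous_const

theorem integral_linearMap_twirl :
    ∫ U : QU ι, F (tensorPow t (U : Op ι) * X * (tensorPow t (U : Op ι))ᴴ) ∂haarUnitary ι
      = F (haarTwirl ι t X) := by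
  have integrable_term : ∀ x y, Integrable (fun U : QU ι =>
      (tensorPow t (U : Op ι) * X * (tensorPow t (U : Op ι))ᴴ) x y * F (Matrix.single x y 1))
      (haarUnitary ι) := fun x y =>
    integrable_haarUnitary_of_continuous ((continuous_twirl_apply X x y).mul continuous_const)
  simp only [linearMap_apply_eq_sum F (_ * _ * _)]
  rw [linearMap_apply_eq_sum F (haarTwirl ι t X),
    integral_finsetSum _ fun x _ => integrable_finsetSum _ fun y _ => integrable_term x y]
  refine Finset.sum_congr rfl fun x _ => ?_
  rw [integral_finsetSum _ fun y _ => integrable_term x y]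
  exact Finset.sum_congr rfl fun y _ => integral_mul_const _ _

end LinearMapTwirl

section HaarAverage

variable {ι : Type} [Fintype ι] [DecidableEq ι]

theorem integral_haarUnitary_mem_Icc {f : QU ι → ℝ} (hf : Continuous f)
    (hf01 : ∀ U, f U ∈ Set.Icc 0 1) : ∫ U, f U ∂haarUnitary ι ∈ Set.Icc (0 : ℝ) 1 := by
  refine ⟨integral_nonneg fun U => (hf01 U).1, ?_⟩
  calc ∫ U, f U ∂haarUnitary ι ≤ ∫ _, (1 : ℝ) ∂haarUnitary ι :=
        integral_mono (integrable_haarUnitary_of_continuous hf) (integrable_const _)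
          fun U => (hf01 U).2
    _ = 1 := by rw [integral_const, probReal_univ, one_smul]

variable {K : Type} [Fintype K]

theorem integral_keyAverage {f : K → QU ι → ℝ} (hf : ∀ k, Continuous (f k)) :
    ∫ U, keyAverage (fun k => f k U) ∂haarUnitary ι
      = keyAverage fun k => ∫ U, f k U ∂haarUnitary ι := by
  simp only [keyAverage]
  rw [integral_div, integral_finsetSum _ fun k _ => integrable_haarUnitary_of_continuous (hf k)]

theorem keyAverage_const [Nonempty K] (c : ℝ) : keyAverage (fun _ : K => c) = c := by
  rw [keyAverage, Finset.sum_const, nsmul_eq_mul, Finset.card_univ, mul_div_cancel_left₀]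
  exact Nat.cast_ne_zero.2 Fintype.card_ne_zero

theorem integral_keyAverage_mul_right [Nonempty K] {f : QU ι → ℝ} (hf : Continuous f)
    (W : K → QU ι) :
    ∫ U, keyAverage (fun k => f (U * W k)) ∂haarUnitary ι = ∫ U, f U ∂haarUnitary ι := by
  rw [integral_keyAverage (f := fun k U => f (U * W k))
    fun k => hf.comp (continuous_mul_const (W k))]
  simp only [integral_mul_right_eq_self f, keyAverage_const]

end HaarAverage

section HaarEncryption

variable {n m t : ℕ} (l : ℕ) {γ : Type} [Fintype γ] [DecidableEq γ]

theorem continuous_linearMap_applyEach_padState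
    (F : Matrix ((Fin t → Reg (Fin (n + l + m))) × γ) ((Fin t → Reg (Fin (n + l + m))) × γ) ℂ
      →ₗ[ℂ] ℂ) (σ : Fin t → Reg (Fin m))
    (Y : Matrix ((Fin t → Reg (Fin n)) × γ) ((Fin t → Reg (Fin n)) × γ) ℂ) :
    Continuous fun U : QU (Fin (n + l + m)) =>
      F (applyEach (U : Op (Fin (n + l + m))) (padState l σ Y)) := by
  simp only [applyEach_padState, map_sum]
  exact continuous_finsetSum _ fun i _ => continuous_finsetSum _ fun j _ =>
    continuous_linearMap_twirl
      (F ∘ₗ (Matrix.kroneckerBilinear (R := ℂ)).flip (block Y i j)) _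

theorem integral_linearMap_applyEach_padState
    (F : Matrix ((Fin t → Reg (Fin (n + l + m))) × γ) ((Fin t → Reg (Fin (n + l + m))) × γ) ℂ
      →ₗ[ℂ] ℂ) {σ : Fin t → Reg (Fin m)} (hσ : Function.Injective σ)
    {a : Fin t → Reg (Fin (n + l + m))} (ha : Function.Injective a)
    (Y : Matrix ((Fin t → Reg (Fin n)) × γ) ((Fin t → Reg (Fin n)) × γ) ℂ) :
    ∫ U : QU (Fin (n + l + m)), F (applyEach (U : Op (Fin (n + l + m))) (padState l σ Y))
        ∂haarUnitary _
      = F (haarTwirl _ t (Matrix.single a a 1) ⊗ₖ traceFst Y) := by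
  set G : (i j : Fin t → Reg (Fin n)) →
      Matrix (Fin t → Reg (Fin (n + l + m))) (Fin t → Reg (Fin (n + l + m))) ℂ →ₗ[ℂ] ℂ :=
    fun i j => F ∘ₗ (Matrix.kroneckerBilinear (R := ℂ)).flip (block Y i j)
  have G_apply : ∀ i j A, F (A ⊗ₖ block Y i j) = G i j A := fun _ _ _ => rfl
  have integrable_term : ∀ i j, Integrable (fun U : QU (Fin (n + l + m)) =>
      G i j (tensorPow t (U : Op _) * Matrix.single (padInput l σ i) (padInput l σ j) (1 : ℂ) *
        (tensorPow t (U : Op _))ᴴ)) (haarUnitary _) := fun i j =>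
    integrable_haarUnitary_of_continuous (continuous_linearMap_twirl _ _)
  have pad_injective : ∀ i : Fin t → Reg (Fin n), Function.Injective (padInput l σ i) :=
    fun i s s' h => hσ ((padded_inj l).1 h).2
  have off_diagonal : ∀ i j : Fin t → Reg (Fin n), j ≠ i →
      haarTwirl _ t (Matrix.single (padInput l σ i) (padInput l σ j) 1) = 0 := by
    intro i j hij
    obtain ⟨s₀, hs₀⟩ := Function.ne_iff.1 ((padInput_injective l σ).ne hij.symm)
    refine haarTwirl_single_eq_zero (s₀ := s₀) (pad_injective i) ?_
    rintro ⟨s, hs⟩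
    obtain rfl := hσ ((padded_inj l).1 hs).2
    exact hs₀ hs.symm
  simp only [applyEach_padState, map_sum, G_apply]
  rw [integral_finsetSum _ fun i _ => integrable_finsetSum _ fun j _ => integrable_term i j,
    traceFst_eq_sum_block, kronecker_sum, map_sum]
  refine Finset.sum_congr rfl fun i _ => ?_
  rw [integral_finsetSum _ fun j _ => integrable_term i j, Finset.sum_eq_single_of_mem i
    (Finset.mem_univ i), integral_linearMap_twirl, haarTwirl_single_self_eq (pad_injective i) ha]
  · rfl
  · intro j _ hj
    rw [integral_linearMap_twirl, off_diagonal i j hj, map_zero]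

end HaarEncryption

/-! ## Collisions of mixing strings -/

section Birthday

variable {S K : Type} [Fintype S] [DecidableEq S] [Fintype K]

/- Overwriting the value at `s'` by an arbitrary one is injective on functions with
`σ s = σ s'`. -/
theorem card_filter_apply_eq_mul_le [DecidableEq K] {s s' : S} (hs : s ≠ s') :
    (Finset.univ.filter fun σ : S → K => σ s = σ s').card * Fintype.card K
      ≤ Fintype.card (S → K) := by
  rw [← Finset.card_univ, ← Finset.card_univ, ← Finset.card_product]
  refine Finset.card_le_card_of_injOn (fun x => Function.update x.1 s' x.2)
    (fun _ _ => Finset.mem_coe.2 (Finset.mem_univ _)) ?_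
  rintro ⟨σ, v⟩ hσ ⟨τ, w⟩ hτ h
  replace hσ : σ s = σ s' := (Finset.mem_filter.1 (Finset.mem_product.1 hσ).1).2
  replace hτ : τ s = τ s' := (Finset.mem_filter.1 (Finset.mem_product.1 hτ).1).2
  have value_eq : v = w := by simpa using congrFun h s'
  have eq_off : ∀ u, u ≠ s' → σ u = τ u := fun u hu => by simpa [hu] using congrFun h u
  refine Prod.ext (funext fun u => ?_) value_eq
  by_cases hu : u = s'
  · rw [hu]
    exact hσ.symm.trans ((eq_off s hs).trans hτ)
  · exact eq_off u hu

theorem card_not_injective_mul_le [DecidableEq K] :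
    (Finset.univ.filter fun σ : S → K => ¬ Function.Injective σ).card * Fintype.card K
      ≤ Fintype.card S ^ 2 * Fintype.card (S → K) := by
  have subset_biUnion : (Finset.univ.filter fun σ : S → K => ¬ Function.Injective σ) ⊆
      (Finset.univ.filter fun p : S × S => p.1 ≠ p.2).biUnion
        fun p => Finset.univ.filter fun σ : S → K => σ p.1 = σ p.2 := by
    intro σ hσ
    obtain ⟨s, s', h, hne⟩ := Function.not_injective_iff.1 (Finset.mem_filter.1 hσ).2
    simp only [Finset.mem_biUnion, Finset.mem_filter, Finset.mem_univ, true_and]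
    exact ⟨(s, s'), hne, h⟩
  calc _ ≤ (∑ p ∈ Finset.univ.filter fun p : S × S => p.1 ≠ p.2,
        (Finset.univ.filter fun σ : S → K => σ p.1 = σ p.2).card) * Fintype.card K :=
        Nat.mul_le_mul_right _ ((Finset.card_le_card subset_biUnion).trans Finset.card_biUnion_le)
    _ ≤ ∑ _ ∈ Finset.univ.filter fun p : S × S => p.1 ≠ p.2, Fintype.card (S → K) := by
        rw [Finset.sum_mul]
        exact Finset.sum_le_sum fun p hp =>
          card_filter_apply_eq_mul_le (Finset.mem_filter.1 hp).2
    _ ≤ _ := by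
        rw [Finset.sum_const, smul_eq_mul]
        refine Nat.mul_le_mul_right _ ((Finset.card_le_univ _).trans ?_)
        rw [Fintype.card_prod, sq]

theorem abs_keyAverage_sub_le_of_eq_on_injective [Nonempty K] {f g : (S → K) → ℝ}
    (hf : ∀ σ, f σ ∈ Set.Icc 0 1) (hg : ∀ σ, g σ ∈ Set.Icc 0 1)
    (hfg : ∀ σ, Function.Injective σ → f σ = g σ) :
    |keyAverage f - keyAverage g| ≤ (Fintype.card S : ℝ) ^ 2 * (Fintype.card K : ℝ)⁻¹ := by
  classical
  have abs_sub_le : ∀ σ, |f σ - g σ| ≤ if ¬ Function.Injective σ then 1 else 0 := by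
    intro σ
    split_ifs with hσ
    · rw [hfg σ hσ, sub_self, abs_zero]
    · rw [abs_le]
      constructor <;> linarith [(hf σ).1, (hf σ).2, (hg σ).1, (hg σ).2]
  have card_pos : (0 : ℝ) < Fintype.card (S → K) := Nat.cast_pos.2 Fintype.card_pos
  have card_key_pos : (0 : ℝ) < Fintype.card K := Nat.cast_pos.2 Fintype.card_pos
  rw [keyAverage, keyAverage, ← sub_div, ← Finset.sum_sub_distrib, abs_div, abs_of_pos card_pos,
    div_le_iff₀ card_pos]
  calc |∑ σ, (f σ - g σ)| ≤ ∑ σ : S → K, if ¬ Function.Injective σ then (1 : ℝ) else 0 :=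
        (Finset.abs_sum_le_sum_abs _ _).trans (Finset.sum_le_sum fun σ _ => abs_sub_le σ)
    _ = ((Finset.univ.filter fun σ : S → K => ¬ Function.Injective σ).card : ℝ) :=
        Finset.sum_boole _ _
    _ ≤ _ := by
        rw [mul_right_comm, ← div_eq_mul_inv, le_div_iff₀ card_key_pos]
        exact_mod_cast card_not_injective_mul_le (S := S) (K := K)

end Birthday

/-! ## Indistinguishability of ciphertexts under a Haar random unitary -/

section EncryptedProb

variable {n l m t r : ℕ}

theorem flatten_smul_sum {z : ℕ} {K : Type} [Fintype K] (c : ℂ)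
    (X : K → Matrix ((Fin t → Reg (Fin z)) × Reg (Fin r)) ((Fin t → Reg (Fin z)) × Reg (Fin r)) ℂ) :
    flatten (c • ∑ k, X k) = c • ∑ k, flatten (X k) := by
  ext x y
  simp only [flatten_eq_submatrix, Matrix.submatrix_apply, Matrix.smul_apply, Matrix.sum_apply]

theorem IsDensity.flatten {z : ℕ}
    {X : Matrix ((Fin t → Reg (Fin z)) × Reg (Fin r)) ((Fin t → Reg (Fin z)) × Reg (Fin r)) ℂ}
    (hX : IsDensity X) : IsDensity (flatten X) :=
  hX.submatrix_equiv (flattenEquiv t z r)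

theorem exists_linearMap_outputProb_flatten {z : ℕ} (A : Algorithm Gate ((Fin t × Fin z) ⊕ Fin r))
    (b : Bool) :
    ∃ F : Matrix ((Fin t → Reg (Fin z)) × Reg (Fin r)) ((Fin t → Reg (Fin z)) × Reg (Fin r)) ℂ
      →ₗ[ℂ] ℂ, ∀ X, A.outputProb Gate.op (flatten X) b = (F X).re :=
  ⟨Matrix.traceLinearMap _ ℂ ℂ ∘ₗ LinearMap.mulLeft ℂ (A.effect Gate.op b) ∘ₗ
    (Matrix.reindexLinearEquiv ℂ ℂ (flattenEquiv t z r).symm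
      (flattenEquiv t z r).symm).toLinearMap,
    fun X => A.outputProb_eq_re_trace Gate.op (flatten X) b⟩

variable (A : Algorithm Gate ((Fin t × Fin (n + l + m)) ⊕ Fin r)) (b : Bool)
  {Y Y' : Matrix ((Fin t → Reg (Fin n)) × Reg (Fin r)) ((Fin t → Reg (Fin n)) × Reg (Fin r)) ℂ}

theorem continuous_outputProb_applyEach_padState (σ : Fin t → Reg (Fin m))
    (Y : Matrix ((Fin t → Reg (Fin n)) × Reg (Fin r)) ((Fin t → Reg (Fin n)) × Reg (Fin r)) ℂ) :
    Continuous fun U : QU (Fin (n + l + m)) => A.outputProb Gate.op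
      (flatten (applyEach (U : Op (Fin (n + l + m))) (padState l σ Y))) b := by
  obtain ⟨F, hF⟩ := exists_linearMap_outputProb_flatten A b
  simp only [hF]
  exact Complex.continuous_re.comp (continuous_linearMap_applyEach_padState l F σ Y)

theorem integral_outputProb_applyEach_padState_congr {σ : Fin t → Reg (Fin m)}
    (hσ : Function.Injective σ) (hY : traceFst Y = traceFst Y') :
    ∫ U : QU (Fin (n + l + m)), A.outputProb Gate.op
        (flatten (applyEach (U : Op (Fin (n + l + m))) (padState l σ Y))) b ∂haarUnitary _
      = ∫ U : QU (Fin (n + l + m)), A.outputProb Gate.op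
        (flatten (applyEach (U : Op (Fin (n + l + m))) (padState l σ Y'))) b ∂haarUnitary _ := by
  obtain ⟨F, hF⟩ := exists_linearMap_outputProb_flatten A b
  have integral_eq : ∀ Y : Matrix ((Fin t → Reg (Fin n)) × Reg (Fin r)) _ ℂ,
      ∫ U : QU (Fin (n + l + m)),
        (F (applyEach (U : Op (Fin (n + l + m))) (padState l σ Y))).re ∂haarUnitary _
      = (∫ U : QU (Fin (n + l + m)),
        F (applyEach (U : Op (Fin (n + l + m))) (padState l σ Y)) ∂haarUnitary _).re := fun Y =>
    integral_re
      (integrable_haarUnitary_of_continuous (continuous_linearMap_applyEach_padState l F σ Y))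
  have zero_injective : Function.Injective (padInput l σ fun _ (_ : Fin n) => false) :=
    fun s s' h => hσ ((padded_inj l).1 h).2
  simp only [hF, integral_eq, integral_linearMap_applyEach_padState l F hσ zero_injective, hY]

theorem outputProb_applyEach_padState_mem_Icc (hY : IsDensity Y) (σ : Fin t → Reg (Fin m))
    (U : QU (Fin (n + l + m))) :
    A.outputProb Gate.op (flatten (applyEach (U : Op (Fin (n + l + m))) (padState l σ Y))) b
      ∈ Set.Icc 0 1 := by
  have isDensity_ciphertext := ((hY.padState l σ).applyEach U.2).flatten
  exact ⟨A.outputProb_nonneg Gate.op isDensity_ciphertext.1 b,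
    A.outputProb_le_one Gate.op_mem_unitaryGroup isDensity_ciphertext b⟩

/-- The probability that `A` outputs `b` if the `t` inputs in `Y` are encrypted with the scrambling
unitary `U`. -/
def encryptedProb
    (Y : Matrix ((Fin t → Reg (Fin n)) × Reg (Fin r)) ((Fin t → Reg (Fin n)) × Reg (Fin r)) ℂ)
    (U : QU (Fin (n + l + m))) : ℝ :=
  A.outputProb Gate.op (flatten (parallel t (padAndScramble n l m U) Y)) b

theorem encryptedProb_eq_keyAverage
    (Y : Matrix ((Fin t → Reg (Fin n)) × Reg (Fin r)) ((Fin t → Reg (Fin n)) × Reg (Fin r)) ℂ)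
    (U : QU (Fin (n + l + m))) :
    encryptedProb A b Y U = keyAverage fun σ : Fin t → Reg (Fin m) =>
      A.outputProb Gate.op
        (flatten (applyEach (U : Op (Fin (n + l + m))) (padState l σ Y))) b := by
  rw [encryptedProb, parallel_padAndScramble, flatten_smul_sum, Algorithm.outputProb_average]

theorem continuous_encryptedProb
    (Y : Matrix ((Fin t → Reg (Fin n)) × Reg (Fin r)) ((Fin t → Reg (Fin n)) × Reg (Fin r)) ℂ) :
    Continuous (encryptedProb (l := l) (m := m) A b Y) := by
  simp only [funext (encryptedProb_eq_keyAverage A b Y)]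
  exact (continuous_finsetSum _ fun σ _ =>
    continuous_outputProb_applyEach_padState A b σ Y).div_const _

theorem abs_integral_encryptedProb_sub_le (hY : IsDensity Y) (hY' : IsDensity Y')
    (h : traceFst Y = traceFst Y') :
    |∫ U, encryptedProb A b Y U ∂haarUnitary (Fin (n + l + m))
        - ∫ U, encryptedProb A b Y' U ∂haarUnitary (Fin (n + l + m))|
      ≤ (t : ℝ) ^ 2 * (2 ^ m)⁻¹ := by
  have card_mix : (Fintype.card (Reg (Fin m)) : ℝ) = 2 ^ m := by
    simp only [Fintype.card_fun, Fintype.card_fin, Fintype.card_bool, Nat.cast_pow, Nat.cast_ofNat]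
  simp only [encryptedProb_eq_keyAverage]
  rw [integral_keyAverage fun σ => continuous_outputProb_applyEach_padState A b σ Y,
    integral_keyAverage fun σ => continuous_outputProb_applyEach_padState A b σ Y', ← card_mix]
  conv_rhs => rw [← Fintype.card_fin t]
  exact abs_keyAverage_sub_le_of_eq_on_injective
    (fun σ => integral_haarUnitary_mem_Icc (continuous_outputProb_applyEach_padState A b σ Y)
      (outputProb_applyEach_padState_mem_Icc A b hY σ))
    (fun σ => integral_haarUnitary_mem_Icc (continuous_outputProb_applyEach_padState A b σ Y')
      (outputProb_applyEach_padState_mem_Icc A b hY' σ))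
    fun σ hσ => integral_outputProb_applyEach_padState_congr A b hσ h

end EncryptedProb

/-! ## The reduction to pseudorandomness -/

section AverageCiphertext

variable {n l m t r : ℕ} {K : Type} [Fintype K]

/-- The state of the ciphertexts and the reference if the inputs in `Y` are encrypted with the
scrambling unitary `W k` for a uniformly random key `k`. -/
def averageCiphertext (W : K → QU (Fin (n + l + m)))
    (Y : Matrix ((Fin t → Reg (Fin n)) × Reg (Fin r)) ((Fin t → Reg (Fin n)) × Reg (Fin r)) ℂ) :
    Matrix ((Fin t → Reg (Fin (n + l + m))) × Reg (Fin r))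
      ((Fin t → Reg (Fin (n + l + m))) × Reg (Fin r)) ℂ :=
  (Fintype.card K : ℂ)⁻¹ • ∑ k, parallel t (padAndScramble n l m (W k)) Y

theorem IsDensity.averageCiphertext [Nonempty K] (W : K → QU (Fin (n + l + m)))
    {Y : Matrix ((Fin t → Reg (Fin n)) × Reg (Fin r)) ((Fin t → Reg (Fin n)) × Reg (Fin r)) ℂ}
    (hY : IsDensity Y) : IsDensity (averageCiphertext W Y) :=
  IsDensity.average fun k => hY.parallel_padAndScramble (W k)

theorem outputProb_afterQueries_averageCiphertext
    (A : Algorithm Gate ((Fin t × Fin (n + l + m)) ⊕ Fin r)) (b : Bool)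
    (Y : Matrix ((Fin t → Reg (Fin n)) × Reg (Fin r)) ((Fin t → Reg (Fin n)) × Reg (Fin r)) ℂ)
    (W : K → QU (Fin (n + l + m))) (U : QU (Fin (n + l + m))) :
    A.afterQueries.outputProb (OracleGate.op U) (flatten (averageCiphertext W Y)) b
      = keyAverage fun k => encryptedProb A b Y (U * W k) := by
  rw [averageCiphertext, flatten_smul_sum, Algorithm.outputProb_average]
  refine congrArg keyAverage (funext fun k => ?_)
  rw [encryptedProb, ← applyEach_parallel_padAndScramble]
  exact A.outputProb_afterQueries U _ b

theorem encryptedProb_false_add_encryptedProb_true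
    (A : Algorithm Gate ((Fin t × Fin (n + l + m)) ⊕ Fin r))
    {Y : Matrix ((Fin t → Reg (Fin n)) × Reg (Fin r)) ((Fin t → Reg (Fin n)) × Reg (Fin r)) ℂ}
    (hY : IsDensity Y) (U : QU (Fin (n + l + m))) :
    encryptedProb A false Y U + encryptedProb A true Y U = 1 :=
  A.outputProb_false_add_outputProb_true Gate.op_mem_unitaryGroup
    (hY.parallel_padAndScramble U).flatten

theorem keyAverage_prod {L : Type} [Fintype L] (f : K × L → ℝ) :
    keyAverage f = keyAverage fun k => keyAverage fun l => f (k, l) := by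
  simp only [keyAverage, Fintype.sum_prod_type, Fintype.card_prod, ← Finset.sum_div]
  rw [div_div, mul_comm (Fintype.card K), Nat.cast_mul]

theorem keyAverage_add (f g : K → ℝ) :
    keyAverage (fun k => f k + g k) = keyAverage f + keyAverage g := by
  rw [keyAverage, keyAverage, keyAverage, Finset.sum_add_distrib, add_div]

end AverageCiphertext

/-- The advantage of an oracle adversary in distinguishing a random member of the family `V` from
a Haar random unitary. -/
def OracleAdversary.advantage {z : ℕ → ℕ} {K : Type} [Fintype K] (B : OracleAdversary z) (n : ℕ)
    (V : K → QU (Fin (z n))) : ℝ :=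
  |keyAverage (fun k => B.accept n (V k)) - ∫ U, B.accept n U ∂haarUnitary (Fin (z n))|

/-- A non-adaptive QPT adversary in the left-or-right experiment for channels from `n` to `z n`
qubits: a `CPAAdversary` that is not tied to a particular scheme. -/
structure LeftRightAdversary (z : ℕ → ℕ) where
  t : ℕ → ℕ
  r : ℕ → ℕ
  state : ∀ n, Matrix ((Fin (t n) → Reg (Fin n) × Reg (Fin n)) × Reg (Fin (r n)))
    ((Fin (t n) → Reg (Fin n) × Reg (Fin n)) × Reg (Fin (r n))) ℂ
  state_density : ∀ n, IsDensity (state n)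
  alg : ∀ n, Algorithm Gate ((Fin (t n) × Fin (z n)) ⊕ Fin (r n))
  t_poly : PolyBounded t
  r_poly : PolyBounded r
  alg_poly : PolyBounded fun n => (alg n).size

namespace LeftRightAdversary

section Experiment

variable {z : ℕ → ℕ} {K : Type} [Fintype K] (A : LeftRightAdversary z) (n : ℕ)
  (Φ : K → Op (Fin n) →ₗ[ℂ] Op (Fin (z n)))

/-- The probability that the adversary outputs `b'` in the left-or-right experiment with bit `b`,
where the channel is `Φ k` for a uniformly random key `k`. -/
def outputProb (b b' : Bool) : ℝ :=
  keyAverage fun k => (A.alg n).outputProb Gate.op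
    (flatten (parallel (A.t n) (leftRight (Φ k) b) (A.state n))) b'

/-- The distinguishing advantage `|Pr[A = 1 | b = 0] - Pr[A = 1 | b = 1]|`. -/
def advantage : ℝ :=
  |A.outputProb n Φ false true - A.outputProb n Φ true true|

/-- The probability that the adversary guesses a uniformly random bit `b`. -/
def successProb : ℝ :=
  (∑ b : Bool, A.outputProb n Φ b b) / 2

end Experiment

variable {tag mix : ℕ → ℕ} (A : LeftRightAdversary fun n => n + tag n + mix n)
  {K : Type} [Fintype K] (n : ℕ)

/-- The inputs that are encrypted if the bit is `b`, and the reference. -/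
def selected (b : Bool) :
    Matrix ((Fin (A.t n) → Reg (Fin n)) × Reg (Fin (A.r n)))
      ((Fin (A.t n) → Reg (Fin n)) × Reg (Fin (A.r n))) ℂ :=
  selectInput b (A.state n)

theorem isDensity_selected (b : Bool) : IsDensity (A.selected n b) :=
  (A.state_density n).selectInput b

theorem outputProb_padAndScramble (U : K → QU (Fin (n + tag n + mix n))) (b b' : Bool) :
    A.outputProb n (fun k => padAndScramble n (tag n) (mix n) (U k)) b b'
      = keyAverage fun k => encryptedProb (A.alg n) b' (A.selected n b) (U k) := by
  simp only [outputProb, parallel_leftRight]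
  rfl

theorem outputProb_false_add_outputProb_true [Nonempty K]
    (U : K → QU (Fin (n + tag n + mix n))) (b : Bool) :
    A.outputProb n (fun k => padAndScramble n (tag n) (mix n) (U k)) b false
      + A.outputProb n (fun k => padAndScramble n (tag n) (mix n) (U k)) b true = 1 := by
  simp only [outputProb_padAndScramble, ← keyAverage_add,
    encryptedProb_false_add_encryptedProb_true (A.alg n) (A.isDensity_selected n b),
    keyAverage_const]

theorem successProb_le_half_add_advantage [Nonempty K] (U : K → QU (Fin (n + tag n + mix n))) :
    A.successProb n (fun k => padAndScramble n (tag n) (mix n) (U k))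
      ≤ 1 / 2 + A.advantage n (fun k => padAndScramble n (tag n) (mix n) (U k)) := by
  have complement := A.outputProb_false_add_outputProb_true n U false
  have bias_le := neg_abs_le
    (A.outputProb n (fun k => padAndScramble n (tag n) (mix n) (U k)) false true
      - A.outputProb n (fun k => padAndScramble n (tag n) (mix n) (U k)) true true)
  have advantage_nonneg := abs_nonneg
    (A.outputProb n (fun k => padAndScramble n (tag n) (mix n) (U k)) false true
      - A.outputProb n (fun k => padAndScramble n (tag n) (mix n) (U k)) true true)
  rw [successProb, advantage, Fintype.sum_bool]
  linarith

section Reduction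

variable {L : ℕ → Type} [∀ n, Fintype (L n)] [∀ n, Nonempty (L n)]
  (htag : PolyBounded tag) (hmix : PolyBounded mix)
  (W : ∀ n, L n → QU (Fin (n + tag n + mix n))) (b : Bool)

/-- The adversary against the oracle `U` that simulates the left-or-right experiment with bit `b`
for the scrambling unitaries `U * W n k`. Its advice holds the inputs already padded and scrambled
by `W n k`, averaged over `k`, so `W` need not be efficient. -/
def oracleAdversary : OracleAdversary fun n => n + tag n + mix n where
  wires n := A.t n * (n + tag n + mix n) + A.r n
  advice n := (flatten (averageCiphertext (W n) (A.selected n b))).submatrix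
    (regEquiv (wireEquiv _ _ _)) (regEquiv (wireEquiv _ _ _))
  advice_density n :=
    ((A.isDensity_selected n b).averageCiphertext (W n)).flatten.submatrix_equiv _
  alg n := Algorithm.relabel (wireEquiv _ _ _) (A.alg n).afterQueries
  wires_poly := (A.t_poly.mul ((polyBounded_id.add htag).add hmix)).add A.r_poly
  alg_poly := (A.alg_poly.add A.t_poly).mono fun n =>
    ((A.alg n).size_relabel_afterQueries _).le

theorem accept_oracleAdversary (U : QU (Fin (n + tag n + mix n))) :
    (A.oracleAdversary htag hmix W b).accept n U
      = keyAverage fun k => encryptedProb (A.alg n) true (A.selected n b) (U * W n k) :=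
  (Algorithm.outputProb_relabel _ _ _ _ _).trans
    (outputProb_afterQueries_averageCiphertext _ _ _ _ _)

theorem keyAverage_accept_oracleAdversary (V : K → QU (Fin (n + tag n + mix n))) :
    keyAverage (fun k => (A.oracleAdversary htag hmix W b).accept n (V k))
      = A.outputProb n
        (fun k : K × L n => padAndScramble n (tag n) (mix n) (V k.1 * W n k.2)) b true := by
  simp only [accept_oracleAdversary, outputProb_padAndScramble, keyAverage_prod]

theorem integral_accept_oracleAdversary :
    ∫ U, (A.oracleAdversary htag hmix W b).accept n U ∂haarUnitary (Fin (n + tag n + mix n))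
      = ∫ U, encryptedProb (A.alg n) true (A.selected n b) U
        ∂haarUnitary (Fin (n + tag n + mix n)) := by
  simp only [accept_oracleAdversary]
  exact integral_keyAverage_mul_right (continuous_encryptedProb _ _ _) (W n)

theorem advantage_le (V : K → QU (Fin (n + tag n + mix n))) :
    A.advantage n (fun k : K × L n => padAndScramble n (tag n) (mix n) (V k.1 * W n k.2))
      ≤ (A.oracleAdversary htag hmix W false).advantage n V
        + (A.oracleAdversary htag hmix W true).advantage n V
        + (A.t n : ℝ) ^ 2 * (2 ^ mix n)⁻¹ := by
  have traceFst_eq : traceFst (A.selected n false) = traceFst (A.selected n true) :=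
    (traceFst_selectInput false (A.state n)).trans (traceFst_selectInput true (A.state n)).symm
  have haar_le := abs_integral_encryptedProb_sub_le (A.alg n) true (A.isDensity_selected n false)
    (A.isDensity_selected n true) traceFst_eq
  simp only [OracleAdversary.advantage, advantage, keyAverage_accept_oracleAdversary,
    integral_accept_oracleAdversary]
  exact (dist_triangle4_right (α := ℝ) _ _ _ _).trans (add_le_add_right haar_le _)

theorem superpolynomialDecay_advantage {len : ℕ → ℕ}
    {V : ∀ n, Reg (Fin (len n)) → QU (Fin (n + tag n + mix n))}
    (htag : PolyBounded tag) (hmix : PolyBounded mix)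
    (hV : IsPRU (fun n => n + tag n + mix n) len V) (hlog : SuperLogarithmic mix) :
    SuperpolynomialDecay atTop (fun n : ℕ => (n : ℝ)) fun n => A.advantage n
      fun k : Reg (Fin (len n)) × L n =>
        padAndScramble n (tag n) (mix n) (V n k.1 * W n k.2) := by
  obtain ⟨p, hp⟩ := hV.poly_lam
  have pru_decay : ∀ b, SuperpolynomialDecay atTop (fun n : ℕ => (n : ℝ)) fun n =>
      (A.oracleAdversary htag hmix W b).advantage n (V n) := fun b =>
    superpolynomialDecay_of_param_le_natEval ((hV.pseudorandom _).superpolynomialDecay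
      (fun _ => abs_nonneg _) (tendsto_atTop_of_le_natEval p hp)) p hp
  have collision_decay : SuperpolynomialDecay atTop (fun n : ℕ => (n : ℝ)) fun n =>
      (A.t n : ℝ) ^ 2 * (2 ^ mix n)⁻¹ := by
    simpa only [← sq, Nat.cast_pow] using
      (A.t_poly.mul A.t_poly).mul_superpolynomialDecay hlog.superpolynomialDecay
  refine (((pru_decay false).add (pru_decay true)).add collision_decay).trans_abs_le fun n => ?_
  exact (abs_abs _).trans_le ((A.advantage_le n htag hmix W (V n)).trans (le_abs_self _))

end Reduction

end LeftRightAdversary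

end QCrypto

end

theorem mainTheorem3_general {tag mix len lam : ℕ → ℕ} (htag : QCrypto.PolyBounded tag)
    (hmix : QCrypto.PolyBounded mix) (hlog : QCrypto.SuperLogarithmic mix)
    {V : ∀ n, QCrypto.Reg (Fin (len n)) → QCrypto.QU (Fin (n + tag n + mix n))}
    (hV : QCrypto.IsPRU (fun n => n + tag n + mix n) len V)
    {L : ℕ → Type} [∀ n, Fintype (L n)] [∀ n, Nonempty (L n)]
    (W : ∀ n, L n → QCrypto.QU (Fin (n + tag n + mix n)))
    {Φ : ∀ n, QCrypto.Reg (Fin (len n)) × L n →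
      QCrypto.Op (Fin n) →ₗ[ℂ] QCrypto.Op (Fin (n + tag n + mix n))}
    (hΦ : ∀ n k, Φ n k = QCrypto.padAndScramble n (tag n) (mix n) (V n k.1 * W n k.2))
    (hlen : ∀ n, len n ≤ lam n) (hlam : QCrypto.PolyBounded lam)
    (A : QCrypto.LeftRightAdversary fun n => n + tag n + mix n) :
    QCrypto.NegligibleIn lam (fun n => A.advantage n (Φ n)) ∧
      ∃ μ : ℕ → ℝ, QCrypto.Negligible μ ∧ ∀ n, A.successProb n (Φ n) ≤ 1 / 2 + μ (lam n) := by
  obtain rfl : Φ = fun n k => QCrypto.padAndScramble n (tag n) (mix n) (V n k.1 * W n k.2) :=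
    funext fun n => funext (hΦ n)
  obtain ⟨p, hp⟩ := hV.poly_lam
  obtain ⟨q, hq⟩ := hlam
  have lam_tendsto : Tendsto lam atTop atTop :=
    tendsto_atTop_mono hlen (QCrypto.tendsto_atTop_of_le_natEval p hp)
  obtain ⟨μ, hμ, advantage_le⟩ : QCrypto.NegligibleIn lam _ :=
    QCrypto.negligibleIn_of_superpolynomialDecay lam_tendsto
      (QCrypto.superpolynomialDecay_of_param_le_natEval
        (s := fun n => n) (A.superpolynomialDecay_advantage W htag hmix hV hlog) q hq)
  exact ⟨⟨μ, hμ, advantage_le⟩, μ, hμ, fun n =>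
    (A.successProb_le_half_add_advantage n _).trans (add_le_add_right (advantage_le n) _)⟩

theorem mainTheorem3 (P : QCrypto.PQAS) (A : QCrypto.CPAAdversary P) :
    QCrypto.NegligibleIn P.lam A.advantage ∧
      ∃ μ : ℕ → ℝ, QCrypto.Negligible μ ∧ ∀ n, A.successProb n ≤ 1 / 2 + μ (P.lam n) :=
  mainTheorem3_general (L := fun _ => _ × _) P.tag_poly P.mix_poly P.mix_superlog P.pru
    (fun n k => P.V₂ n k.1 * P.V₃ n k.2)
    (fun n _ => congrArg (QCrypto.padAndScramble n (P.tag n) (P.mix n)) (mul_assoc _ _ _))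
    (fun _ => (Nat.le_add_right _ _).trans (Nat.le_add_right _ _)) P.key_poly
    ⟨A.t, A.r, A.state, A.state_density, A.alg, A.t_poly, A.r_poly, A.alg_poly⟩
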